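/- Conventions. Let $B$ be a separable real Banach space with norm $\|\cdot\|$. A sequence $(X_i)_{i\ge 0}$ of $B$-valued random variables on a probability space $(\Omega,\mathcal F,\mathbb P)$ is a martingale difference sequence with respect to a non-decreasing sequence $(\mathcal F_i)_{i\ge 0}$ of sub-$\sigma$-algebras of $\mathcal F$ if each $X_i$ is $\mathcal F_i$-measurable with $\mathbb E\|X_i\|<\infty$, and $\mathbb E[X_{i}\mid\mathcal F_{i-1}]=0$ almost surely for all $i\ge 1$. For $1<r\le 2$ and a real number $D$, the space $B$ is called $(r,D)$-smooth if (i) there is an equivalent norm $N$ on $B$ with $$\sup_{t>0}\ \frac1{t^r}\sup\{N(x+ty)+N(x-ty)-2 : N(x)=N(y)=1\}<\infty ,$$ and (ii) every sequence $(X_i)_{i\ge0}$ of $B$-valued martingale differences satisfies $\mathbb E\big\|\sum_{i=0}^{n-1}X_i\big\|^r\le D\sum_{i=0}^{n-1}\mathbb E\|X_i\|^r$ for all $n$. Theorem. For all real numbers $p,q,D$ with $1<p<q$ there are constants $C,c>0$, depending only on $p$, $q$ and $D$, such that the following holds. Let $r\in[p,2]$ and let $B$ be an $(r,D)$-smooth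 separable Banach space. Let $(\Omega,\mathcal F,\mathbb P)$ be a probability space, $T:\Omega\to\Omega$ a bijective, bi-measurable, measure preserving map, $\mathcal F_0\subset\mathcal F$ a sub-$\sigma$-algebra with $T\mathcal F_0\subset\mathcal F_0$, and $m:\Omega\to B$ such that $(m\circ T^i)_{i\ge 0}$ is a martingale difference sequence with respect to $(T^{-i}\mathcal F_0)_{i\ge 0}$. Put $S_i(m)=\sum_{j=0}^{i-1}m\circ T^j$. Then for all integers $n\ge 1$ and all $x>0$, $$\mathbb P\Big\{\max_{1\le i\le n}\|S_i(m)\|>xn^{1/p}\Big\}\le Cn\int_0^1\mathbb P\{\|m\|>cxun^{1/p}\}\,u^{q-1}\,du+C\int_0^{\infty}\mathbb P\big\{\mathbb E[\|m\|^p\mid T\mathcal F_0]>cx^pu^p\big\}\min\{u^{q-1},u^{p-1}\}\,du$$ and $$\mathbb P\Big\{\max_{1\le i\le n}\|S_i(m)\|>xn^{1/p}\Big\}\le C\int_0^{\infty}\mathbb P\{\|m\|>xu\}\min\{u^{q-1},u^{p-1}\}\,du .$$ Here $\mathbb E[\|m\|^p\mid T\mathcal F_0]$ is the $[0,\infty]$-valued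 conditional expectation of a non-negative random variable, and the integrals take values in $[0,\infty]$ (no moment of $m$ of order $p$ is assumed). -/

import Mathlib

open MeasureTheory ProbabilityTheory
open scoped ENNReal NNReal

universe u v

/-- `X 0, X 1, …` is a sequence of `B`-valued martingale differences with respect to the
non-decreasing sequence `F 0, F 1, …` of sub-σ-algebras of the ambient σ-algebra: every `X i` is
`F i`-measurable and integrable, and `E[X (i + 1) | F i] = 0` almost surely. -/
structure IsMartingaleDifference {B : Type u} [NormedAddCommGroup B] [NormedSpace ℝ B]
    [CompleteSpace B] {Ω : Type v} {mΩ : MeasurableSpace Ω} (P : Measure Ω)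
    (X : ℕ → Ω → B) (F : ℕ → MeasurableSpace Ω) : Prop where
  mono : Monotone F
  le : ∀ i, F i ≤ mΩ
  measurable : ∀ i, StronglyMeasurable[F i] (X i)
  integrable : ∀ i, Integrable (X i) P
  condExp_eq_zero : ∀ i, P[X (i + 1) | F i] =ᵐ[P] 0

/-- `B` is `r`-smooth (`1 < r ≤ 2`): there is an equivalent norm `N` on `B` with
`sup_{t > 0} t ^ (-r) * sup {N (x + t y) + N (x - t y) - 2 : N x = N y = 1} < ∞`. -/
def IsSmoothSpace (B : Type u) [NormedAddCommGroup B] [NormedSpace ℝ B] (r : ℝ) : Prop :=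
  1 < r ∧ r ≤ 2 ∧
    ∃ N : Seminorm ℝ B,
      (∃ a b : ℝ, 0 < a ∧ 0 < b ∧ ∀ x : B, a * ‖x‖ ≤ N x ∧ N x ≤ b * ‖x‖) ∧
      ∃ K : ℝ, ∀ t : ℝ, 0 < t → ∀ x y : B, N x = 1 → N y = 1 →
        (N (x + t • y) + N (x - t • y) - 2) / t ^ r ≤ K

/-- `B` is `(r, D)`-smooth: it is `r`-smooth, and every sequence of `B`-valued martingale
differences, on every probability space, satisfies
`E ‖X_0 + ⋯ + X_{n-1}‖ ^ r ≤ D * (E ‖X_0‖ ^ r + ⋯ + E ‖X_{n-1}‖ ^ r)` for all `n`.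
The moments are `[0, ∞]`-valued. (`B` being Polish, the property does not depend on the universe
over which the probability space `Ω` ranges.) -/
def IsSmoothSpaceWith (B : Type u) [NormedAddCommGroup B] [NormedSpace ℝ B] [CompleteSpace B]
    (r D : ℝ) : Prop :=
  IsSmoothSpace B r ∧
    ∀ (Ω : Type v) (_mΩ : MeasurableSpace Ω) (P : Measure Ω), IsProbabilityMeasure P →
      ∀ (X : ℕ → Ω → B) (F : ℕ → MeasurableSpace Ω), IsMartingaleDifference P X F →
        ∀ n : ℕ, ∫⁻ ω, ‖∑ i ∈ Finset.range n, X i ω‖ₑ ^ r ∂P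
          ≤ ENNReal.ofReal D * ∑ i ∈ Finset.range n, ∫⁻ ω, ‖X i ω‖ₑ ^ r ∂P

/-- `max_{1 ≤ i ≤ n} ‖S_i(m)‖` at `ω`, where `S_i(m) = ∑_{j < i} m ∘ T ^ j`. -/
noncomputable def maxNormPartialSum {B : Type u} [NormedAddCommGroup B] {Ω : Type v}
    (T : Ω → Ω) (m : Ω → B) (n : ℕ) (ω : Ω) : ℝ≥0 :=
  (Finset.Icc 1 n).sup fun i => ‖birkhoffSum T m i ω‖₊

/-!
The proof is Burkholder's good-λ method, with Tonelli's theorem turning tails into moments.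

Let `X` be a martingale difference sequence with partial sums `S`, and let `Z i` be the conditional
moment `E[‖X (i + 1)‖ ^ p | F i]`. If `‖S‖` passes the level `3 * l` while all increments are at most
`a = δ * l` and the `Z i` add up to at most `a ^ p`, then the increments collected between the passage
times of `l` and of `3 * l` add up to at least `2 * l - a`. Between these times, which form a
predictable set, the increments may be replaced by increments truncated at `a` and recentred: the
recentring costs at most `a ^ (1 - p) * ∑ Z i ≤ a`. Smoothness of order `r ≥ p`, applied to the
resulting martingale, bounds its moment of order `r` by a constant times `a ^ r * P (max ‖S‖ > l)`,
since truncation at `a` makes a moment of order `r` at most `a ^ (r - p)` times one of order `p`.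
No moment of order `p` is needed, because the `Z i` that enter are bounded on the predictable set.
This is `IsMartingaleDifference.good_lambda`:
`P (max ‖S‖ > 3 l) ≤ 3 ^ (-q) P (max ‖S‖ > l) + P (max ‖X i‖ > δ l) + P (∑ Z i > (δ l) ^ p)`
for small `δ`. Iterating it (`le_lintegral_of_three_mul_le`) bounds the tail of the maximum by
integrals over `u ∈ (0, 1]` of the two error terms against `u ^ (q - 1)`.

For `X i = m ∘ T^[i]` the first error term is at most `n P (‖m‖ > ·)`. The second one concerns the sum
of fewer than `n` terms `E[‖X (i + 1)‖ ^ p | F i]`, all translates of one variable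
(`condMoment_comp_iterate`). Truncating at the level `a` and applying Markov's inequality gives
`P (∑ Z i > 2 n a) ≤ E[W 1_{W > a}] / a` (`measure_lt_sum_condLExp_le`), where `W` may be either
`E[‖m‖ ^ p | T F₀]` or `‖m‖ ^ p`; the two choices lead to the two assertions. By Tonelli, all the
integrated tails are comparable with moments of `min (V ^ q) (V ^ p)` (`tailWeight`); the condition
`p < q` makes `∫ u ^ (q - p - 1) du` converge at `0`.
-/

/-! ### Band sums and truncated conditional means -/

/-- The partial sums of `d` up to time `i` have exceeded the level `l` in norm, but not yet the
level `3 * l`. -/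
def InBand {B : Type u} [NormedAddCommGroup B] (d : ℕ → B) (l : ℝ) (i : ℕ) : Prop :=
  (∃ j ≤ i, l < ‖∑ k ∈ Finset.range j, d k‖) ∧ ∀ j ≤ i, ‖∑ k ∈ Finset.range j, d k‖ ≤ 3 * l

lemma not_inBand_zero {B : Type u} [NormedAddCommGroup B] (d : ℕ → B) {l : ℝ} (hl : 0 < l) :
    ¬ InBand d l 0 := by
  rintro ⟨⟨j, hj, h⟩, -⟩
  obtain rfl : j = 0 := by omega
  simp at h
  linarith

open Classical in
/-- If the partial sums reach the level `3 * l` while the increments are at most `a`, then the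
increments collected between the passage times of the levels `l` and `3 * l` sum up to at least
`2 * l - a`. -/
lemma le_norm_sum_inBand {B : Type u} [NormedAddCommGroup B] (d : ℕ → B) {l a : ℝ} (hl : 0 < l)
    {n : ℕ} (hd : ∀ i < n, ‖d i‖ ≤ a) (h : ∃ k ≤ n, 3 * l < ‖∑ i ∈ Finset.range k, d i‖) :
    2 * l - a ≤ ‖∑ i ∈ Finset.range n, if InBand d l i then d i else 0‖ := by
  set S : ℕ → B := fun k => ∑ i ∈ Finset.range k, d i with hS
  have h3 : ∃ k, 3 * l < ‖S k‖ := h.imp fun _ => And.right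
  have h1 : ∃ k, l < ‖S k‖ := h3.imp fun k hk => by linarith
  set σ := Nat.find h3
  set τ := Nat.find h1
  have hσ : 3 * l < ‖S σ‖ := Nat.find_spec h3
  have hτ : l < ‖S τ‖ := Nat.find_spec h1
  have hσn : σ ≤ n := by
    obtain ⟨k, hk, hk'⟩ := h
    exact (Nat.find_min' h3 hk').trans hk
  have hτσ : τ ≤ σ := Nat.find_min' h1 (by linarith)
  have hτ0 : τ ≠ 0 := by
    intro h0
    rw [h0] at hτ
    simp [hS] at hτ
    linarith
  have hband : ∀ i, InBand d l i ↔ τ ≤ i ∧ i < σ := by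
    intro i
    constructor
    · rintro ⟨⟨j, hj, hj'⟩, h'⟩
      refine ⟨(Nat.find_min' h1 hj').trans hj, ?_⟩
      by_contra! hc
      exact (h' σ hc).not_gt hσ
    · rintro ⟨ha, hb⟩
      refine ⟨⟨τ, ha, hτ⟩, fun j hj => ?_⟩
      exact not_lt.1 (Nat.find_min h3 (lt_of_le_of_lt hj hb))
  have hsum : (∑ i ∈ Finset.range n, if InBand d l i then d i else 0) = S σ - S τ := by
    rw [hS, ← Finset.sum_Ico_eq_sub _ hτσ, ← Finset.sum_filter]
    congr 1
    ext i
    simp only [Finset.mem_filter, Finset.mem_range, hband, Finset.mem_Ico]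
    omega
  obtain ⟨t, ht⟩ := Nat.exists_eq_succ_of_ne_zero hτ0
  have hSt : ‖S τ‖ ≤ l + a := by
    have h2 : ‖S t‖ ≤ l := not_lt.1 (Nat.find_min h1 (show t < τ by omega))
    have h4 : S τ = S t + d t := by rw [ht]; exact Finset.sum_range_succ _ _
    rw [h4]
    exact (norm_add_le _ _).trans (add_le_add h2 (hd t (by omega)))
  rw [hsum]
  have := norm_sub_norm_le (S σ) (S τ)
  linarith

open Classical in
/-- Among the indices at which the running sum of `z` is at most `c`, the terms of `z` add up to at
most `c`. -/
lemma sum_ite_le_of_partial_sum_le (z : ℕ → ℝ≥0∞) (Q : ℕ → Prop) {c : ℝ≥0∞}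
    (h : ∀ i, Q i → ∑ j ∈ Finset.range (i + 1), z j ≤ c) (n : ℕ) :
    (∑ i ∈ Finset.range n, if Q i then z i else 0) ≤ c := by
  induction n with
  | zero => simp
  | succ n ih =>
    by_cases hQ : Q n
    · refine le_trans (Finset.sum_le_sum fun i _ => ?_) (h n hQ)
      split_ifs <;> simp
    · rw [Finset.sum_range_succ, if_neg hQ, add_zero]
      exact ih

/-- A truncated conditional Markov inequality: the conditional mean of the part of `X` above the
level `α` is at most `α ^ (1 - p)` times the conditional moment of order `p`. -/
lemma enorm_condExp_indicator_le {B : Type u} [NormedAddCommGroup B] [NormedSpace ℝ B]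
    [CompleteSpace B] {Ω : Type v} {G mΩ : MeasurableSpace Ω} {P : Measure Ω}
    [IsProbabilityMeasure P] {X : Ω → B} (hX : StronglyMeasurable X)
    (hXi : Integrable X P) {p : ℝ} (hp : 1 ≤ p) {α : ℝ≥0∞} (hα : α ≠ 0) (hα' : α ≠ ∞) :
    ∀ᵐ ω ∂P, ‖(P[{ω | α < ‖X ω‖ₑ}.indicator X | G]) ω‖ₑ
      ≤ α ^ (1 - p) * condLExp G P (fun ω => ‖X ω‖ₑ ^ p) ω := by
  have hm : MeasurableSet {ω | α < ‖X ω‖ₑ} := measurableSet_lt measurable_const hX.enorm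
  set g := {ω | α < ‖X ω‖ₑ}.indicator X with hg
  have hgi : Integrable g P := hXi.indicator hm
  have h1 := norm_condExp_le (μ := P) (m := G) g
  have h2 := condLExp_ofReal G hgi.norm (Filter.Eventually.of_forall fun _ => norm_nonneg _)
  have h3 : condLExp G P (fun ω => ENNReal.ofReal ‖g ω‖)
      ≤ᵐ[P] condLExp G P ((α ^ (1 - p)) • fun ω => ‖X ω‖ₑ ^ p) := by
    refine condLExp_mono (Filter.Eventually.of_forall fun ω => ?_)
    simp only [ofReal_norm, Pi.smul_apply, smul_eq_mul]
    by_cases hω : α < ‖X ω‖ₑ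
    · rw [hg, Set.indicator_of_mem (by exact hω)]
      have hX0 : ‖X ω‖ₑ ≠ 0 := (lt_of_le_of_lt zero_le hω).ne'
      calc ‖X ω‖ₑ = ‖X ω‖ₑ ^ (1 - p) * ‖X ω‖ₑ ^ p := by
            rw [← ENNReal.rpow_add _ _ hX0 enorm_ne_top]; simp
        _ ≤ _ := by
            gcongr ?_ * _
            rw [← neg_sub p 1, ENNReal.rpow_neg, ENNReal.rpow_neg, ENNReal.inv_le_inv]
            exact ENNReal.rpow_le_rpow hω.le (by linarith)
    · rw [hg, Set.indicator_of_notMem (by exact hω)]; simp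
  have h4 := condLExp_smul' (mΩ := G) (P := P) (fun ω => ‖X ω‖ₑ ^ p) (c := α ^ (1 - p))
    (ENNReal.rpow_ne_top_of_ne_zero hα hα')
  filter_upwards [h1, h2, h3, h4] with ω w1 w2 w3 w4
  rw [w4, w2] at w3
  refine le_trans ?_ w3
  rw [← ofReal_norm]
  exact ENNReal.ofReal_le_ofReal w1

/-! ### The truncated and stopped martingale -/

section Transform

variable {B : Type u} [NormedAddCommGroup B]
  {Ω : Type v} {mΩ : MeasurableSpace Ω} (P : Measure Ω) (X : ℕ → Ω → B)
  (F : ℕ → MeasurableSpace Ω)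

/-- The conditional moment `E[‖X (i + 1)‖ ^ p | F i]`. -/
noncomputable def condMoment (p : ℝ) (i : ℕ) : Ω → ℝ≥0∞ :=
  condLExp (F i) P fun ω => ‖X (i + 1) ω‖ₑ ^ p

lemma measurable_condMoment (p : ℝ) (i : ℕ) : Measurable[F i] (condMoment P X F p i) :=
  measurable_condLExp _ _ _

/-- The `F i`-measurable event that the partial sums up to time `i + 1` lie in the band between `l`
and `3 * l`, while the conditional moments up to time `i` sum up to at most `α ^ p`. -/
def activeSet (p l : ℝ) (α : ℝ≥0∞) (i : ℕ) : Set Ω :=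
  {ω | InBand (fun k => X k ω) l (i + 1) ∧
    ∑ j ∈ Finset.range (i + 1), condMoment P X F p j ω ≤ α ^ p}

/-- The part of `X (i + 1)` of norm larger than `α`. -/
noncomputable def largePart (α : ℝ≥0∞) (i : ℕ) : Ω → B :=
  {ω | α < ‖X (i + 1) ω‖ₑ}.indicator (X (i + 1))

variable [NormedSpace ℝ B] [CompleteSpace B]

/-- The martingale differences obtained from `X` by truncating at the level `α`, recentring, and
keeping only the increments whose predictable `activeSet` occurs. -/
noncomputable def bandTransform (p l : ℝ) (α : ℝ≥0∞) : ℕ → Ω → B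
  | 0 => 0
  | i + 1 => (activeSet P X F p l α i).indicator
      (X (i + 1) - largePart X α i + P[largePart X α i | F i])

variable {P X F}

lemma IsMartingaleDifference.measurable_of_le (hX : IsMartingaleDifference P X F) {i j : ℕ}
    (hij : i ≤ j) : StronglyMeasurable[F j] (X i) :=
  (hX.measurable i).mono (hX.mono hij)

lemma IsMartingaleDifference.measurable_sum (hX : IsMartingaleDifference P X F) {i j : ℕ}
    (hij : j ≤ i + 1) :
    Measurable[F i] (fun ω => ‖∑ k ∈ Finset.range j, X k ω‖) := by
  refine StronglyMeasurable.measurable ?_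
  refine StronglyMeasurable.norm ?_
  refine Finset.stronglyMeasurable_fun_sum _ fun k hk => hX.measurable_of_le ?_
  have := Finset.mem_range.1 hk
  omega

lemma IsMartingaleDifference.measurableSet_activeSet (hX : IsMartingaleDifference P X F)
    (p l : ℝ) (α : ℝ≥0∞) (i : ℕ) : MeasurableSet[F i] (activeSet P X F p l α i) := by
  have h : activeSet P X F p l α i
      = ((⋃ j, ⋃ (_ : j ≤ i + 1), {ω | l < ‖∑ k ∈ Finset.range j, X k ω‖}) ∩
        (⋂ j, ⋂ (_ : j ≤ i + 1), {ω | ‖∑ k ∈ Finset.range j, X k ω‖ ≤ 3 * l})) ∩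
        {ω | ∑ j ∈ Finset.range (i + 1), condMoment P X F p j ω ≤ α ^ p} := by
    ext ω
    simp [activeSet, InBand]
  rw [h]
  refine MeasurableSet.inter (MeasurableSet.inter ?_ ?_) ?_
  · exact MeasurableSet.iUnion fun j => MeasurableSet.iUnion fun hj =>
      measurableSet_lt measurable_const (hX.measurable_sum hj)
  · exact MeasurableSet.iInter fun j => MeasurableSet.iInter fun hj =>
      measurableSet_le (hX.measurable_sum hj) measurable_const
  · refine measurableSet_le (Finset.measurable_fun_sum _ fun j hj => ?_) measurable_const
    have := Finset.mem_range.1 hj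
    exact (measurable_condMoment P X F p j).mono (hX.mono (by omega)) le_rfl

lemma IsMartingaleDifference.stronglyMeasurable_largePart (hX : IsMartingaleDifference P X F)
    (α : ℝ≥0∞) (i : ℕ) : StronglyMeasurable[F (i + 1)] (largePart X α i) := by
  refine StronglyMeasurable.indicator (hX.measurable _) ?_
  exact measurableSet_lt measurable_const (hX.measurable _).enorm

lemma IsMartingaleDifference.integrable_largePart (hX : IsMartingaleDifference P X F)
    (α : ℝ≥0∞) (i : ℕ) : Integrable (largePart X α i) P := by
  refine (hX.integrable _).indicator ?_
  exact measurableSet_lt measurable_const ((hX.measurable _).mono (hX.le _)).enorm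

lemma IsMartingaleDifference.isMartingaleDifference_bandTransform [IsProbabilityMeasure P]
    (hX : IsMartingaleDifference P X F) (p l : ℝ) (α : ℝ≥0∞) :
    IsMartingaleDifference P (bandTransform P X F p l α) F where
  mono := hX.mono
  le := hX.le
  measurable := by
    rintro (_ | i)
    · exact stronglyMeasurable_zero
    · refine StronglyMeasurable.indicator ?_
        (hX.mono (Nat.le_succ i) _ (hX.measurableSet_activeSet p l α i))
      exact ((hX.measurable _).sub (hX.stronglyMeasurable_largePart α i)).add
        (stronglyMeasurable_condExp.mono (hX.mono (Nat.le_succ i)))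
  integrable := by
    rintro (_ | i)
    · exact integrable_zero _ _ _
    · exact (((hX.integrable _).sub (hX.integrable_largePart α i)).add
        integrable_condExp).indicator (hX.le i _ (hX.measurableSet_activeSet p l α i))
  condExp_eq_zero := by
    intro i
    have hg := hX.integrable_largePart α i
    have h1 := condExp_indicator (m := F i)
      (((hX.integrable (i + 1)).sub hg).add
        (integrable_condExp (m := F i) (f := largePart X α i)))
      (hX.measurableSet_activeSet p l α i)
    have h2 := condExp_add ((hX.integrable (i + 1)).sub hg)
      (integrable_condExp (m := F i) (f := largePart X α i)) (F i)
    have h3 := condExp_sub (hX.integrable (i + 1)) hg (F i)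
    have h4 := condExp_of_stronglyMeasurable (hX.le i)
      (stronglyMeasurable_condExp (m := F i) (μ := P) (f := largePart X α i)) integrable_condExp
    filter_upwards [h1, h2, h3, hX.condExp_eq_zero i] with ω w1 w2 w3 w4
    refine w1.trans ?_
    simp only [Set.indicator]
    split_ifs
    · rw [w2, Pi.add_apply, w3, h4, Pi.sub_apply, w4]; simp
    · rfl

/-- Pointwise bound of the transformed increments. The truncated part is at most `α`, and so is the
recentring term, since `condMoment` is at most `α ^ p` on the active set; this trades the exponent `r`
for `p` at the price of `α ^ (r - p)`. -/
lemma IsMartingaleDifference.enorm_bandTransform_rpow_le [IsProbabilityMeasure P]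
    (hX : IsMartingaleDifference P X F) {p r : ℝ} (hp : 1 ≤ p) (hr : p ≤ r) (l : ℝ) {α : ℝ≥0∞}
    (hα : α ≠ 0) (hα' : α ≠ ∞) (i : ℕ) :
    ∀ᵐ ω ∂P, ‖bandTransform P X F p l α (i + 1) ω‖ₑ ^ r ≤ 2 ^ (r - 1) * α ^ (r - p) *
      (activeSet P X F p l α i).indicator
        (fun ω => ‖X (i + 1) ω‖ₑ ^ p + condMoment P X F p i ω) ω := by
  filter_upwards [enorm_condExp_indicator_le (P := P) (G := F i)
    ((hX.measurable (i + 1)).mono (hX.le _)) (hX.integrable _) hp hα hα'] with ω hω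
  rw [bandTransform]
  by_cases hA : ω ∈ activeSet P X F p l α i
  swap
  · simp [hA, ENNReal.zero_rpow_of_pos (show 0 < r by linarith)]
  simp only [Set.indicator_of_mem hA, Pi.add_apply, Pi.sub_apply]
  set Z := condMoment P X F p i ω with hZ
  set e := P[largePart X α i | F i] ω with he
  have he1 : ‖e‖ₑ ≤ α ^ (1 - p) * Z := hω
  have hZ1 : Z ≤ α ^ p :=
    (Finset.single_le_sum (f := fun j => condMoment P X F p j ω) (fun _ _ => zero_le)
      (Finset.self_mem_range_succ i)).trans hA.2
  have he2 : ‖e‖ₑ ≤ α := by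
    refine he1.trans ((mul_le_mul_right hZ1 _).trans ?_)
    rw [← ENNReal.rpow_add _ _ hα hα']; simp
  have he3 : ‖e‖ₑ ^ r ≤ α ^ (r - p) * Z := by
    calc ‖e‖ₑ ^ r = ‖e‖ₑ ^ (r - 1) * ‖e‖ₑ ^ (1 : ℝ) := by
          rw [← ENNReal.rpow_add_of_nonneg _ _ (by linarith) zero_le_one]; simp
      _ ≤ α ^ (r - 1) * (α ^ (1 - p) * Z) := by
          rw [ENNReal.rpow_one]
          gcongr
          linarith
      _ = _ := by
          rw [← mul_assoc, ← ENNReal.rpow_add _ _ hα hα']; congr 2; ring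
  have hf : ‖X (i + 1) ω - largePart X α i ω‖ₑ ^ r ≤ α ^ (r - p) * ‖X (i + 1) ω‖ₑ ^ p := by
    by_cases hl : α < ‖X (i + 1) ω‖ₑ
    · rw [largePart, Set.indicator_of_mem (by exact hl)]
      simp [ENNReal.zero_rpow_of_pos (show 0 < r by linarith)]
    · rw [largePart, Set.indicator_of_notMem (by exact hl), sub_zero]
      calc ‖X (i + 1) ω‖ₑ ^ r = ‖X (i + 1) ω‖ₑ ^ (r - p) * ‖X (i + 1) ω‖ₑ ^ p := by
            rw [← ENNReal.rpow_add_of_nonneg _ _ (by linarith) (by linarith)]; simp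
        _ ≤ _ := by
            gcongr ?_ * _
            exact ENNReal.rpow_le_rpow (not_lt.1 hl) (by linarith)
  calc ‖X (i + 1) ω - largePart X α i ω + e‖ₑ ^ r
      ≤ (‖X (i + 1) ω - largePart X α i ω‖ₑ + ‖e‖ₑ) ^ r := by
        gcongr
        · linarith
        · exact enorm_add_le _ _
    _ ≤ 2 ^ (r - 1) * (‖X (i + 1) ω - largePart X α i ω‖ₑ ^ r + ‖e‖ₑ ^ r) :=
        ENNReal.rpow_add_le_mul_rpow_add_rpow _ _ (by linarith)
    _ ≤ 2 ^ (r - 1) * (α ^ (r - p) * ‖X (i + 1) ω‖ₑ ^ p + α ^ (r - p) * Z) := by gcongr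
    _ = _ := by ring

lemma IsMartingaleDifference.lintegral_enorm_bandTransform_rpow_le [IsProbabilityMeasure P]
    (hX : IsMartingaleDifference P X F) {p r : ℝ} (hp : 1 ≤ p) (hr : p ≤ r) (l : ℝ) {α : ℝ≥0∞}
    (hα : α ≠ 0) (hα' : α ≠ ∞) (i : ℕ) :
    ∫⁻ ω, ‖bandTransform P X F p l α (i + 1) ω‖ₑ ^ r ∂P ≤ 2 ^ r * α ^ (r - p) *
      ∫⁻ ω, (activeSet P X F p l α i).indicator (condMoment P X F p i) ω ∂P := by
  have hA := hX.measurableSet_activeSet p l α i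
  have hA' := hX.le i _ hA
  refine (lintegral_mono_ae (hX.enorm_bandTransform_rpow_le hp hr l hα hα' i)).trans ?_
  rw [lintegral_const_mul' _ _ (ENNReal.mul_ne_top (by simp)
    (ENNReal.rpow_ne_top_of_nonneg (by linarith) hα')), lintegral_indicator hA',
    lintegral_indicator hA', lintegral_add_right _ ((measurable_condMoment P X F p i).mono (hX.le i) le_rfl),
    condMoment, setLIntegral_condLExp (hX.le i) P _ hA, ← two_mul]
  have h2 : (2 : ℝ≥0∞) ^ r = 2 ^ (r - 1) * 2 := by
    simpa using ENNReal.rpow_add (r - 1) 1 two_ne_zero ENNReal.ofNat_ne_top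
  rw [h2]
  exact le_of_eq (by ring)

end Transform

/-! ### The good-λ inequality and its iteration -/

section GoodLambda

variable {B : Type u} [NormedAddCommGroup B] [NormedSpace ℝ B] [CompleteSpace B]
  {Ω : Type v} {mΩ : MeasurableSpace Ω} {P : Measure Ω} {X : ℕ → Ω → B}
  {F : ℕ → MeasurableSpace Ω}

lemma IsMartingaleDifference.measurableSet_exceed (hX : IsMartingaleDifference P X F) (n : ℕ)
    (l : ℝ) : MeasurableSet {ω | ∃ k ≤ n, l < ‖∑ i ∈ Finset.range k, X i ω‖} := by
  have h : {ω | ∃ k ≤ n, l < ‖∑ i ∈ Finset.range k, X i ω‖}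
      = ⋃ k, ⋃ (_ : k ≤ n), {ω | l < ‖∑ i ∈ Finset.range k, X i ω‖} := by
    ext ω
    simp
  rw [h]
  exact MeasurableSet.iUnion fun k => MeasurableSet.iUnion fun _ =>
    measurableSet_lt measurable_const ((hX.measurable_sum (Nat.le_succ k)).mono (hX.le k) le_rfl)

/-- The transformed martingale is large whenever the partial sums of `X` exceed `3 * l` although the
increments and the conditional moments stay small. -/
lemma IsMartingaleDifference.ofReal_le_enorm_sum_bandTransform [IsProbabilityMeasure P]
    (hX : IsMartingaleDifference P X F) {p : ℝ} (hp : 1 ≤ p) {l a : ℝ} (ha : 0 < a)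
    (hal : 2 * a ≤ l) (N : ℕ) :
    ∀ᵐ ω ∂P, (∃ k ≤ N + 1, 3 * l < ‖∑ i ∈ Finset.range k, X i ω‖) →
      (∀ i < N + 1, ‖X i ω‖ ≤ a) →
      ∑ j ∈ Finset.range N, condMoment P X F p j ω ≤ ENNReal.ofReal a ^ p →
      ENNReal.ofReal l ≤
        ‖∑ i ∈ Finset.range (N + 1), bandTransform P X F p l (ENNReal.ofReal a) i ω‖ₑ := by
  classical
  set α := ENNReal.ofReal a with hαdef
  have hα : α ≠ 0 := by simpa [hαdef] using ha
  have hα' : α ≠ ∞ := ENNReal.ofReal_ne_top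
  have hae : ∀ᵐ ω ∂P, ∀ i, ‖(P[largePart X α i | F i]) ω‖ₑ
      ≤ α ^ (1 - p) * condMoment P X F p i ω :=
    ae_all_iff.2 fun i => enorm_condExp_indicator_le
      ((hX.measurable (i + 1)).mono (hX.le _)) (hX.integrable _) hp hα hα'
  filter_upwards [hae] with ω hω h3 hd hZ
  set e : ℕ → B := fun i => (P[largePart X α i | F i]) ω with he
  set d : ℕ → B := fun i => X i ω with hddef
  have hband := le_norm_sum_inBand d (l := l) (a := a) (by linarith) hd h3
  rw [Finset.sum_range_succ', if_neg (not_inBand_zero d (by linarith)), add_zero] at hband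
  have hY : ∀ i ∈ Finset.range N, bandTransform P X F p l α (i + 1) ω
      = (if InBand d l (i + 1) then d (i + 1) else 0)
        + (if InBand d l (i + 1) then e i else 0) := by
    intro i hi
    have hi' := Finset.mem_range.1 hi
    have hmem : ω ∈ activeSet P X F p l α i ↔ InBand d l (i + 1) := by
      refine ⟨And.left, fun h => ⟨h, le_trans ?_ hZ⟩⟩
      exact Finset.sum_le_sum_of_subset (Finset.range_mono (by omega))
    have hg : largePart X α i ω = 0 := by
      refine Set.indicator_of_notMem ?_ _
      rw [Set.mem_ofPred_eq, not_lt, ← ofReal_norm]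
      exact ENNReal.ofReal_le_ofReal (hd (i + 1) (by omega))
    rw [bandTransform, Set.indicator_apply]
    simp only [hmem]
    split_ifs
    · simp [hg, he, hddef]
    · simp
  have hsum : ∑ i ∈ Finset.range (N + 1), bandTransform P X F p l α i ω
      = (∑ i ∈ Finset.range N, if InBand d l (i + 1) then d (i + 1) else 0)
        + ∑ i ∈ Finset.range N, if InBand d l (i + 1) then e i else 0 := by
    rw [Finset.sum_range_succ', Finset.sum_congr rfl hY, Finset.sum_add_distrib]
    simp [bandTransform]
  have hesum : ‖∑ i ∈ Finset.range N, if InBand d l (i + 1) then e i else 0‖ ≤ a := by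
    have h1 : ‖∑ i ∈ Finset.range N, if InBand d l (i + 1) then e i else 0‖ₑ ≤ α := by
      calc _ ≤ ∑ i ∈ Finset.range N, ‖if InBand d l (i + 1) then e i else 0‖ₑ :=
            enorm_sum_le _ _
        _ ≤ ∑ i ∈ Finset.range N, α ^ (1 - p) * condMoment P X F p i ω := by
            refine Finset.sum_le_sum fun i _ => ?_
            split_ifs
            · exact hω i
            · simp
        _ ≤ α ^ (1 - p) * α ^ p := by rw [← Finset.mul_sum]; gcongr
        _ = α := by rw [← ENNReal.rpow_add _ _ hα hα']; simp
    rw [← ofReal_norm] at h1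
    exact (ENNReal.ofReal_le_ofReal_iff ha.le).1 h1
  rw [hsum, ← ofReal_norm]
  refine ENNReal.ofReal_le_ofReal ?_
  have := norm_sub_le_norm_add
    (∑ i ∈ Finset.range N, if InBand d l (i + 1) then d (i + 1) else 0)
    (∑ i ∈ Finset.range N, if InBand d l (i + 1) then e i else 0)
  linarith

/-- The active conditional moments add up to at most `α ^ p`, and they all vanish unless the partial
sums exceed `l`. -/
lemma IsMartingaleDifference.sum_lintegral_active_le (hX : IsMartingaleDifference P X F)
    (p l : ℝ) (α : ℝ≥0∞) (N : ℕ) :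
    ∑ i ∈ Finset.range N,
        ∫⁻ ω, (activeSet P X F p l α i).indicator (condMoment P X F p i) ω ∂P
      ≤ α ^ p * P {ω | ∃ k ≤ N + 1, l < ‖∑ i ∈ Finset.range k, X i ω‖} := by
  classical
  rw [← lintegral_finsetSum]
  swap
  · intro i _
    exact ((measurable_condMoment P X F p i).mono (hX.le i) le_rfl).indicator
      (hX.le i _ (hX.measurableSet_activeSet p l α i))
  rw [← lintegral_indicator_const (hX.measurableSet_exceed (N + 1) l)]
  refine lintegral_mono fun ω => ?_
  by_cases hω : ω ∈ {ω | ∃ k ≤ N + 1, l < ‖∑ i ∈ Finset.range k, X i ω‖}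
  · rw [Set.indicator_of_mem hω]
    simp only [Set.indicator_apply]
    exact sum_ite_le_of_partial_sum_le (fun i => condMoment P X F p i ω)
      (fun i => ω ∈ activeSet P X F p l α i) (fun i hi => hi.2) N
  · refine le_trans (le_of_eq (Finset.sum_eq_zero fun i hi => ?_)) zero_le
    refine Set.indicator_of_notMem (fun hA => hω ?_) _
    obtain ⟨⟨⟨j, hj, hj'⟩, -⟩, -⟩ := hA
    have := Finset.mem_range.1 hi
    exact ⟨j, by omega, hj'⟩

/-- Burkholder's good-λ inequality, for increments controlled by their size and by their conditional
moments of order `p`. The last index is `N + 1`, so that exactly the conditional moments of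
`X 1, …, X N` enter; `X 0` has no conditional mean and never lies in the band. -/
theorem IsMartingaleDifference.good_lambda [IsProbabilityMeasure P]
    (hX : IsMartingaleDifference P X F) {p r : ℝ} {D : ℝ≥0∞} (hp : 1 ≤ p) (hr : p ≤ r)
    (hsmooth : ∀ Y : ℕ → Ω → B, IsMartingaleDifference P Y F → ∀ n : ℕ,
      ∫⁻ ω, ‖∑ i ∈ Finset.range n, Y i ω‖ₑ ^ r ∂P
        ≤ D * ∑ i ∈ Finset.range n, ∫⁻ ω, ‖Y i ω‖ₑ ^ r ∂P)
    {l a : ℝ} (ha : 0 < a) (hal : 2 * a ≤ l) (N : ℕ) :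
    P {ω | ∃ k ≤ N + 1, 3 * l < ‖∑ i ∈ Finset.range k, X i ω‖}
      ≤ D * 2 ^ r * ENNReal.ofReal (a / l) ^ r *
          P {ω | ∃ k ≤ N + 1, l < ‖∑ i ∈ Finset.range k, X i ω‖}
        + (P {ω | ∃ i < N + 1, a < ‖X i ω‖}
        + P {ω | ENNReal.ofReal a ^ p < ∑ j ∈ Finset.range N, condMoment P X F p j ω}) := by
  set α := ENNReal.ofReal a with hαdef
  have hα : α ≠ 0 := by simpa [hαdef] using ha
  have hα' : α ≠ ∞ := ENNReal.ofReal_ne_top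
  have hl : 0 < l := by linarith
  have hr0 : 0 < r := by linarith
  set Λ := ENNReal.ofReal l with hΛdef
  have hΛ : Λ ≠ 0 := by simpa [hΛdef] using hl
  have hΛ' : Λ ≠ ∞ := ENNReal.ofReal_ne_top
  have hY := hX.isMartingaleDifference_bandTransform p l α
  set Y := bandTransform P X F p l α with hYdef
  set M := P {ω | ∃ k ≤ N + 1, l < ‖∑ i ∈ Finset.range k, X i ω‖} with hM
  have hmom : ∫⁻ ω, ‖∑ i ∈ Finset.range (N + 1), Y i ω‖ₑ ^ r ∂P ≤ D * 2 ^ r * α ^ r * M := by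
    refine (hsmooth Y hY (N + 1)).trans ?_
    have h0 : ∫⁻ ω, ‖Y 0 ω‖ₑ ^ r ∂P = 0 := by
      simp [hYdef, bandTransform, ENNReal.zero_rpow_of_pos hr0]
    rw [Finset.sum_range_succ', h0, add_zero]
    calc D * ∑ i ∈ Finset.range N, ∫⁻ ω, ‖Y (i + 1) ω‖ₑ ^ r ∂P
        ≤ D * ∑ i ∈ Finset.range N, 2 ^ r * α ^ (r - p) *
          ∫⁻ ω, (activeSet P X F p l α i).indicator (condMoment P X F p i) ω ∂P := by
          gcongr with i
          exact hX.lintegral_enorm_bandTransform_rpow_le hp hr l hα hα' i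
      _ ≤ D * (2 ^ r * α ^ (r - p) * (α ^ p * M)) := by
          rw [← Finset.mul_sum]
          gcongr
          exact hX.sum_lintegral_active_le p l α N
      _ = D * 2 ^ r * (α ^ (r - p) * α ^ p) * M := by ring
      _ = _ := by rw [← ENNReal.rpow_add _ _ hα hα', sub_add_cancel]
  have hmark : P {ω | Λ ≤ ‖∑ i ∈ Finset.range (N + 1), Y i ω‖ₑ}
      ≤ D * 2 ^ r * ENNReal.ofReal (a / l) ^ r * M := by
    have hset : {ω | Λ ≤ ‖∑ i ∈ Finset.range (N + 1), Y i ω‖ₑ}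
        = {ω | Λ ^ r ≤ ‖∑ i ∈ Finset.range (N + 1), Y i ω‖ₑ ^ r} := by
      ext ω
      simp [ENNReal.rpow_le_rpow_iff hr0]
    have hmeas : StronglyMeasurable[mΩ] fun ω => ∑ i ∈ Finset.range (N + 1), Y i ω :=
      Finset.stronglyMeasurable_fun_sum _ fun i _ => (hY.measurable i).mono (hY.le i)
    rw [hset]
    refine (meas_ge_le_lintegral_div (hmeas.enorm.pow_const r).aemeasurable
      (ENNReal.rpow_pos (pos_iff_ne_zero.2 hΛ) hΛ').ne' (ENNReal.rpow_ne_top_of_nonneg hr0.le hΛ')).trans ?_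
    rw [ENNReal.ofReal_div_of_pos hl, ENNReal.div_rpow_of_nonneg _ _ hr0.le]
    calc _ ≤ D * 2 ^ r * α ^ r * M / Λ ^ r := by gcongr
      _ = _ := by simp only [div_eq_mul_inv]; ring
  calc P {ω | ∃ k ≤ N + 1, 3 * l < ‖∑ i ∈ Finset.range k, X i ω‖}
      ≤ P ({ω | Λ ≤ ‖∑ i ∈ Finset.range (N + 1), Y i ω‖ₑ} ∪
          ({ω | ∃ i < N + 1, a < ‖X i ω‖} ∪
          {ω | α ^ p < ∑ j ∈ Finset.range N, condMoment P X F p j ω})) := by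
        refine measure_mono_ae ?_
        filter_upwards [hX.ofReal_le_enorm_sum_bandTransform hp ha hal N] with ω hω h3
        by_contra hc
        replace hc : ¬ (Λ ≤ ‖∑ i ∈ Finset.range (N + 1), Y i ω‖ₑ ∨ (∃ i < N + 1, a < ‖X i ω‖) ∨
          α ^ p < ∑ j ∈ Finset.range N, condMoment P X F p j ω) := hc
        simp only [not_or, not_lt, not_exists, not_and] at hc
        exact hc.1 (hω h3 hc.2.1 hc.2.2)
    _ ≤ _ := (measure_union_le _ _).trans (add_le_add hmark (measure_union_le _ _))

end GoodLambda

open Set in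
/-- Iteration of the good-λ inequality: if the tail `g` contracts by the factor `3 ^ (-q)` up to an
error `h` when the level is divided by three, then `g` is bounded by a weighted integral of `h`. -/
lemma le_lintegral_of_three_mul_le {q : ℝ} (hq : 1 ≤ q) {g h : ℝ → ℝ≥0∞} (hg : ∀ y, g y ≤ 1)
    (hh : AntitoneOn h (Ioi 0))
    (H : ∀ l, 0 < l → g (3 * l) ≤ ENNReal.ofReal (3 ^ (-q)) * g l + h l) {y : ℝ} (hy : 0 < y) :
    g (3 * y) ≤ ENNReal.ofReal (3 ^ q) *
      ∫⁻ u in Ioc (0 : ℝ) 1, h (y * u) * ENNReal.ofReal (u ^ (q - 1)) := by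
  set I : ℝ → ℝ≥0∞ := fun y => ∫⁻ u in Ioc (0 : ℝ) 1, h (y * u) * ENNReal.ofReal (u ^ (q - 1))
    with hI
  set ε : ℝ≥0∞ := ENNReal.ofReal (3 ^ (-q)) with hε
  have hεq : ENNReal.ofReal (3 ^ q) * ε = 1 := by
    rw [hε, ← ENNReal.ofReal_mul (by positivity), ← Real.rpow_add (by norm_num)]
    simp
  -- Split the integral at `1 / 3`: the first part is a rescaled copy of the whole, and on the second
  -- part both factors are bounded below.
  have hstep : ∀ y, 0 < y → ε * I (y / 3) + ε * h y ≤ I y := by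
    intro y hy
    have hsplit : I y = (∫⁻ u in Ioc (0 : ℝ) (1 / 3), h (y * u) * ENNReal.ofReal (u ^ (q - 1)))
        + ∫⁻ u in Ioc (1 / 3 : ℝ) 1, h (y * u) * ENNReal.ofReal (u ^ (q - 1)) := by
      rw [hI, ← lintegral_union measurableSet_Ioc (Ioc_disjoint_Ioc_of_le le_rfl),
        Ioc_union_Ioc_eq_Ioc (by norm_num) (by norm_num)]
    have himage : (fun v : ℝ => v / 3) '' Ioc 0 1 = Ioc 0 (1 / 3) := by
      ext u
      constructor
      · rintro ⟨v, ⟨h0, h1⟩, rfl⟩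
        exact ⟨by positivity, by simp only; linarith⟩
      · rintro ⟨h0, h1⟩
        exact ⟨3 * u, ⟨by positivity, by linarith⟩, by simp⟩
    have hfirst : (∫⁻ u in Ioc (0 : ℝ) (1 / 3), h (y * u) * ENNReal.ofReal (u ^ (q - 1)))
        = ε * I (y / 3) := by
      rw [← himage, lintegral_image_eq_lintegral_abs_deriv_mul (f := fun v : ℝ => v / 3) (f' := fun _ => 1 / 3)
        measurableSet_Ioc (fun v _ => ((hasDerivAt_id v).div_const 3).hasDerivWithinAt)
        (fun v _ w _ hvw => by simpa using hvw),
        hI, ← lintegral_const_mul' _ _ ENNReal.ofReal_ne_top]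
      refine setLIntegral_congr_fun measurableSet_Ioc fun v hv => ?_
      have e1 : y * (v / 3) = y / 3 * v := by ring
      have e2 : ENNReal.ofReal |1 / 3| * ENNReal.ofReal ((v / 3) ^ (q - 1))
          = ε * ENNReal.ofReal (v ^ (q - 1)) := by
        rw [hε, ← ENNReal.ofReal_mul (by positivity), ← ENNReal.ofReal_mul (by positivity),
          Real.div_rpow hv.1.le (by norm_num), Real.rpow_neg (by norm_num),
          Real.rpow_sub (by norm_num : (0 : ℝ) < 3), Real.rpow_one, abs_of_pos (by norm_num)]
        congr 1
        field_simp
      simp only [e1]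
      rw [mul_left_comm, e2]
      ring
    have hsecond : ε * h y
        ≤ ∫⁻ u in Ioc (1 / 3 : ℝ) 1, h (y * u) * ENNReal.ofReal (u ^ (q - 1)) := by
      calc ε * h y ≤ h y * ENNReal.ofReal ((1 / 3) ^ (q - 1)) * volume (Ioc (1 / 3 : ℝ) 1) := by
            rw [Real.volume_Ioc, mul_assoc, ← ENNReal.ofReal_mul (by positivity), mul_comm]
            gcongr
            rw [hε]
            apply ENNReal.ofReal_le_ofReal
            rw [Real.div_rpow (by norm_num) (by norm_num), Real.one_rpow,
              Real.rpow_sub (by norm_num : (0 : ℝ) < 3), Real.rpow_one,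
              Real.rpow_neg (by norm_num)]
            have : (0 : ℝ) < (3 ^ q)⁻¹ := by positivity
            have e : 1 / ((3 : ℝ) ^ q / 3) * (1 - 1 / 3) = 2 * (3 ^ q)⁻¹ := by
              field_simp
              norm_num
            rw [e]
            linarith
        _ = ∫⁻ u in Ioc (1 / 3 : ℝ) 1, h y * ENNReal.ofReal ((1 / 3) ^ (q - 1)) := by
            rw [setLIntegral_const]
        _ ≤ _ := by
            refine setLIntegral_mono' measurableSet_Ioc fun u hu => ?_
            have hu0 : 0 < u := lt_trans (by norm_num) hu.1
            gcongr ?_ * ENNReal.ofReal ?_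
            · refine hh (mem_Ioi.2 (by positivity)) (mem_Ioi.2 hy) ?_
              nlinarith [hu.2]
            · exact Real.rpow_le_rpow (by norm_num) hu.1.le (by linarith)
    rw [hsplit, hfirst]
    gcongr
  have hind : ∀ k : ℕ, ∀ y, 0 < y → g (3 * y) ≤ ε ^ k + ENNReal.ofReal (3 ^ q) * I y := by
    intro k
    induction k with
    | zero => intro y _; exact (hg _).trans (by simp)
    | succ k ih =>
      intro y hy
      have e : y = 3 * (y / 3) := by ring
      calc g (3 * y) ≤ ε * g y + h y := H y hy
        _ ≤ ε * (ε ^ k + ENNReal.ofReal (3 ^ q) * I (y / 3)) + h y := by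
            gcongr
            conv_lhs => rw [e]
            exact ih _ (by positivity)
        _ = ε ^ (k + 1) + (ENNReal.ofReal (3 ^ q) * (ε * I (y / 3)) + 1 * h y) := by
            rw [one_mul, pow_succ]; ring
        _ = ε ^ (k + 1) + ENNReal.ofReal (3 ^ q) * (ε * I (y / 3) + ε * h y) := by
            rw [← hεq]; ring
        _ ≤ _ := by
            gcongr
            exact hstep y hy
  have hε1 : ε < 1 := by
    rw [hε, ENNReal.ofReal_lt_one]
    exact Real.rpow_lt_one_of_one_lt_of_neg (by norm_num) (by linarith)
  have hlim := (ENNReal.tendsto_pow_atTop_nhds_zero_of_lt_one hε1).add_const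
    (ENNReal.ofReal (3 ^ q) * I y)
  rw [zero_add] at hlim
  exact ge_of_tendsto' hlim fun k => hind k y hy

/-! ### Integrated tails -/

/-- The weight `min (V ^ q) (V ^ p)` of a value `V`. Up to constants it is the integral over `(0, V)`
of the density `min (u ^ (q - 1)) (u ^ (p - 1))`. -/
noncomputable def tailWeight (p q : ℝ) (V : ℝ≥0∞) : ℝ≥0∞ := min (V ^ q) (V ^ p)

lemma tailWeight_mul_le {p q : ℝ} (hp : 0 ≤ p) (hpq : p ≤ q) {k : ℝ≥0∞} (hk : 1 ≤ k) (V : ℝ≥0∞) :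
    tailWeight p q (k * V) ≤ k ^ q * tailWeight p q V := by
  rw [tailWeight, tailWeight, ENNReal.mul_rpow_of_nonneg _ _ hp,
    ENNReal.mul_rpow_of_nonneg _ _ (hp.trans hpq), mul_min]
  exact min_le_min le_rfl (mul_le_mul_left (ENNReal.rpow_le_rpow_of_exponent_le hk hpq) _)

open Set in
open Classical in
lemma tailWeight_le_lintegral {p q : ℝ} (hp : 1 ≤ p) (hq : p ≤ q) (V : ℝ≥0∞) :
    ENNReal.ofReal (2 ^ (-q)) * tailWeight p q V ≤ ∫⁻ u in Ioi (0 : ℝ),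
      (if ENNReal.ofReal u < V then 1 else 0) *
        ENNReal.ofReal (min (u ^ (q - 1)) (u ^ (p - 1))) := by
  induction V using ENNReal.recTopCoe with
  | top =>
    refine le_top.trans ?_
    calc (∞ : ℝ≥0∞) = ∫⁻ u in Ioi (1 : ℝ), 1 := by simp
      _ ≤ ∫⁻ u in Ioi (1 : ℝ), (if ENNReal.ofReal u < ∞ then 1 else 0) *
            ENNReal.ofReal (min (u ^ (q - 1)) (u ^ (p - 1))) := by
          refine setLIntegral_mono' measurableSet_Ioi fun u hu => ?_
          rw [if_pos ENNReal.ofReal_lt_top, one_mul, ENNReal.one_le_ofReal]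
          exact le_min (Real.one_le_rpow hu.le (by linarith))
            (Real.one_le_rpow hu.le (by linarith))
      _ ≤ _ := lintegral_mono_set (Ioi_subset_Ioi zero_le_one)
  | coe v =>
    obtain rfl | hv := eq_or_ne v 0
    · simp [tailWeight, ENNReal.zero_rpow_of_pos (show 0 < q by linarith)]
    have hv0 : (0 : ℝ) < v := NNReal.coe_pos.2 (pos_iff_ne_zero.2 hv)
    have hve : (v : ℝ≥0∞) = ENNReal.ofReal v := (ENNReal.ofReal_coe_nnreal).symm
    have hpow : ∀ s : ℝ, 0 < s → s ≤ q →
        (2 : ℝ) ^ (-q) * (v : ℝ) ^ s ≤ ((v : ℝ) / 2) ^ (s - 1) * (v / 2) := by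
      intro s _ hs
      rw [← Real.rpow_add_one (by positivity), sub_add_cancel, Real.div_rpow hv0.le (by norm_num),
        div_eq_mul_inv, ← Real.rpow_neg (by norm_num), mul_comm]
      gcongr
      norm_num
    calc ENNReal.ofReal (2 ^ (-q)) * tailWeight p q v
        ≤ ENNReal.ofReal (min (((v : ℝ) / 2) ^ (q - 1)) (((v : ℝ) / 2) ^ (p - 1)))
            * ENNReal.ofReal (v / 2) := by
          rw [tailWeight, hve, ENNReal.ofReal_rpow_of_pos hv0, ENNReal.ofReal_rpow_of_pos hv0,
            ← ENNReal.ofReal_mono.map_min, ← ENNReal.ofReal_mul (by positivity),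
            ← ENNReal.ofReal_mul (by positivity)]
          apply ENNReal.ofReal_le_ofReal
          rw [mul_min_of_nonneg _ _ (by positivity), min_mul_of_nonneg _ _ (by positivity)]
          exact min_le_min (hpow q (by linarith) le_rfl) (hpow p (by linarith) hq)
      _ = ∫⁻ u in Ioo ((v : ℝ) / 2) v,
            ENNReal.ofReal (min (((v : ℝ) / 2) ^ (q - 1)) (((v : ℝ) / 2) ^ (p - 1))) := by
          rw [setLIntegral_const, Real.volume_Ioo]
          congr 2
          ring
      _ ≤ ∫⁻ u in Ioo ((v : ℝ) / 2) v, (if ENNReal.ofReal u < v then 1 else 0) *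
            ENNReal.ofReal (min (u ^ (q - 1)) (u ^ (p - 1))) := by
          refine setLIntegral_mono' measurableSet_Ioo fun u hu => ?_
          have h1 : ENNReal.ofReal u < v := by
            rw [hve]; exact (ENNReal.ofReal_lt_ofReal_iff hv0).2 hu.2
          rw [if_pos h1, one_mul]
          apply ENNReal.ofReal_le_ofReal
          exact min_le_min (Real.rpow_le_rpow (by positivity) hu.1.le (by linarith))
            (Real.rpow_le_rpow (by positivity) hu.1.le (by linarith))
      _ ≤ _ := lintegral_mono_set fun u hu => lt_trans (by positivity) hu.1

open Set in
open Classical in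
lemma setLIntegral_ite_rpow_le {q : ℝ} (hq : 1 ≤ q) (V : ℝ≥0∞) :
    ∫⁻ u in Ioc (0 : ℝ) 1, (if ENNReal.ofReal u < V then 1 else 0) * ENNReal.ofReal (u ^ (q - 1))
      ≤ min V 1 ^ q := by
  have hmin : min V 1 ≠ ∞ := ((min_le_right V 1).trans_lt ENNReal.one_lt_top).ne
  obtain ⟨t, ht⟩ : ∃ t : ℝ≥0, (t : ℝ≥0∞) = min V 1 := ⟨_, ENNReal.coe_toNNReal hmin⟩
  have hte : (t : ℝ≥0∞) = ENNReal.ofReal t := (ENNReal.ofReal_coe_nnreal).symm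
  calc _ ≤ ∫⁻ u in Ioc (0 : ℝ) 1, (Ioc (0 : ℝ) t).indicator
          (fun _ => ENNReal.ofReal ((t : ℝ) ^ (q - 1))) u := by
        refine setLIntegral_mono' measurableSet_Ioc fun u hu => ?_
        split_ifs with h
        · have h1 : u ≤ t := by
            have : ENNReal.ofReal u ≤ min V 1 := le_min h.le (by
              rw [ENNReal.ofReal_le_one]; exact hu.2)
            rw [← ht, hte] at this
            exact (ENNReal.ofReal_le_ofReal_iff t.coe_nonneg).1 this
          rw [indicator_of_mem (show u ∈ Ioc (0 : ℝ) t from ⟨hu.1, h1⟩), one_mul]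
          exact ENNReal.ofReal_le_ofReal (Real.rpow_le_rpow hu.1.le h1 (by linarith))
        · simp
    _ ≤ ∫⁻ u, (Ioc (0 : ℝ) t).indicator (fun _ => ENNReal.ofReal ((t : ℝ) ^ (q - 1))) u :=
        setLIntegral_le_lintegral _ _
    _ = min V 1 ^ q := by
        rw [lintegral_indicator_const measurableSet_Ioc, Real.volume_Ioc, sub_zero, ← ht, hte,
          ENNReal.ofReal_rpow_of_nonneg t.coe_nonneg (by linarith), ← ENNReal.ofReal_mul (by positivity)]
        congr 1
        obtain h0 | h0 := eq_or_ne (t : ℝ) 0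
        · rw [h0, mul_zero, Real.zero_rpow (by linarith)]
        · rw [← Real.rpow_add_one h0, sub_add_cancel]

open Set in
open Classical in
/-- The scaling by `n ^ (1 / p)` turns `n` copies of a truncated moment of order `q` into the
weight `tailWeight`. -/
lemma nat_mul_setLIntegral_ite_rpow_le {p q : ℝ} (hp : 1 ≤ p) (hq : p ≤ q) {n : ℕ} (hn : 1 ≤ n)
    (V : ℝ≥0∞) :
    (n : ℝ≥0∞) * ∫⁻ u in Ioc (0 : ℝ) 1,
        (if ENNReal.ofReal u < V then 1 else 0) * ENNReal.ofReal (u ^ (q - 1))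
      ≤ tailWeight p q ((n : ℝ≥0∞) ^ (1 / p) * V) := by
  have hp0 : 0 < p := by linarith
  have hn' : (1 : ℝ≥0∞) ≤ n := by exact_mod_cast hn
  refine (mul_le_mul_right (setLIntegral_ite_rpow_le (hp.trans hq) V) _).trans ?_
  rw [tailWeight, ENNReal.mul_rpow_of_nonneg _ _ hp0.le,
    ENNReal.mul_rpow_of_nonneg _ _ (hp0.le.trans hq), ← ENNReal.rpow_mul, ← ENNReal.rpow_mul,
    one_div_mul_cancel hp0.ne', ENNReal.rpow_one]
  refine le_min (mul_le_mul' ?_ (ENNReal.rpow_le_rpow (min_le_left _ _) (by linarith))) ?_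
  · calc (n : ℝ≥0∞) = (n : ℝ≥0∞) ^ (1 : ℝ) := (ENNReal.rpow_one _).symm
      _ ≤ _ := ENNReal.rpow_le_rpow_of_exponent_le hn' (by
        rw [one_div_mul_eq_div, le_div_iff₀ hp0]; linarith)
  · gcongr
    exact (ENNReal.rpow_le_rpow_of_exponent_ge (min_le_right _ _) hq).trans
      (ENNReal.rpow_le_rpow (min_le_left _ _) hp0.le)

open Set in
open Classical in
/-- The power `u ^ (q - p - 1)` is integrable at `0` because `p < q`. -/
lemma rpow_mul_setLIntegral_ite_rpow_le {p q : ℝ} (hp : 0 < p) (hq : p < q) (V : ℝ≥0∞) :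
    V ^ p * ∫⁻ u in Ioc (0 : ℝ) 1,
        (if ENNReal.ofReal u < V then 1 else 0) * ENNReal.ofReal (u ^ (q - p - 1))
      ≤ ENNReal.ofReal (1 / (q - p)) * tailWeight p q V := by
  have hmin : min V 1 ≠ ∞ := ((min_le_right V 1).trans_lt ENNReal.one_lt_top).ne
  obtain ⟨t, ht⟩ : ∃ t : ℝ≥0, (t : ℝ≥0∞) = min V 1 := ⟨_, ENNReal.coe_toNNReal hmin⟩
  have hte : (t : ℝ≥0∞) = ENNReal.ofReal t := (ENNReal.ofReal_coe_nnreal).symm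
  have hs : 0 < q - p := by linarith
  have hint : ∫⁻ u in Ioc (0 : ℝ) 1,
      (if ENNReal.ofReal u < V then 1 else 0) * ENNReal.ofReal (u ^ (q - p - 1))
      ≤ ENNReal.ofReal (1 / (q - p)) * min V 1 ^ (q - p) := by
    calc _ ≤ ∫⁻ u in Ioc (0 : ℝ) 1, (Ioc (0 : ℝ) t).indicator
          (fun u => ENNReal.ofReal (u ^ (q - p - 1))) u := by
          refine setLIntegral_mono' measurableSet_Ioc fun u hu => ?_
          split_ifs with h
          · have h1 : u ≤ t := by
              have : ENNReal.ofReal u ≤ min V 1 := le_min h.le (by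
                rw [ENNReal.ofReal_le_one]; exact hu.2)
              rw [← ht, hte] at this
              exact (ENNReal.ofReal_le_ofReal_iff t.coe_nonneg).1 this
            rw [indicator_of_mem (show u ∈ Ioc (0 : ℝ) t from ⟨hu.1, h1⟩), one_mul]
          · simp
      _ ≤ ∫⁻ u, (Ioc (0 : ℝ) t).indicator (fun u => ENNReal.ofReal (u ^ (q - p - 1))) u :=
          setLIntegral_le_lintegral _ _
      _ = _ := by
          have hii : IntervalIntegrable (fun u : ℝ => u ^ (q - p - 1)) volume 0 t :=
            intervalIntegral.intervalIntegrable_rpow' (by linarith)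
          rw [lintegral_indicator measurableSet_Ioc, ← ofReal_integral_eq_lintegral_ofReal
            ((intervalIntegrable_iff_integrableOn_Ioc_of_le t.coe_nonneg).1 hii)
            ((ae_restrict_iff' measurableSet_Ioc).2
              (Filter.Eventually.of_forall fun u hu => Real.rpow_nonneg hu.1.le _)),
            ← intervalIntegral.integral_of_le t.coe_nonneg, integral_rpow (Or.inl (by linarith)),
            sub_add_cancel, Real.zero_rpow hs.ne', sub_zero, ← ht, hte,
            ENNReal.ofReal_rpow_of_nonneg t.coe_nonneg hs.le, ← ENNReal.ofReal_mul (by positivity)]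
          congr 1
          ring
  refine (mul_le_mul_right hint _).trans ?_
  rw [mul_left_comm]
  gcongr
  refine le_min ?_ ?_
  · calc V ^ p * min V 1 ^ (q - p) ≤ V ^ p * V ^ (q - p) := by
          gcongr
          exact min_le_left _ _
      _ = V ^ q := by
          rw [← ENNReal.rpow_add_of_nonneg _ _ hp.le hs.le, add_sub_cancel]
  · calc V ^ p * min V 1 ^ (q - p) ≤ V ^ p * 1 := by
          gcongr
          exact ENNReal.rpow_le_one (min_le_right _ _) hs.le
      _ = V ^ p := mul_one _

open Classical in
/-- The layer-cake formula: Tonelli's theorem for a tail probability integrated against a weight. -/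
lemma setLIntegral_tail_mul_eq {Ω : Type v} {mΩ : MeasurableSpace Ω} {P : Measure Ω} [SFinite P]
    {V f : Ω → ℝ≥0∞} (hV : Measurable V) (hf : Measurable f) {ρ : ℝ → ℝ≥0∞} (hρ : Measurable ρ)
    (S : Set ℝ) :
    ∫⁻ u in S, (∫⁻ ω in {ω | ENNReal.ofReal u < V ω}, f ω ∂P) * ρ u
      = ∫⁻ ω, f ω * (∫⁻ u in S, (if ENNReal.ofReal u < V ω then 1 else 0) * ρ u) ∂P := by
  have hm : MeasurableSet {z : ℝ × Ω | ENNReal.ofReal z.1 < V z.2} :=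
    measurableSet_lt (ENNReal.measurable_ofReal.comp measurable_fst) (hV.comp measurable_snd)
  have hite : Measurable fun z : ℝ × Ω =>
      (if ENNReal.ofReal z.1 < V z.2 then 1 else 0 : ℝ≥0∞) :=
    Measurable.ite hm measurable_const measurable_const
  calc ∫⁻ u in S, (∫⁻ ω in {ω | ENNReal.ofReal u < V ω}, f ω ∂P) * ρ u
      = ∫⁻ u in S, ∫⁻ ω, f ω * ((if ENNReal.ofReal u < V ω then 1 else 0) * ρ u) ∂P := by
        refine lintegral_congr fun u => ?_
        have hmu : Measurable fun ω => (if ENNReal.ofReal u < V ω then 1 else 0 : ℝ≥0∞) :=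
          hite.comp measurable_prodMk_left
        rw [← lintegral_indicator (measurableSet_lt measurable_const hV), ← lintegral_mul_const]
        · refine lintegral_congr fun ω => ?_
          by_cases h : ENNReal.ofReal u < V ω <;> simp [Set.indicator, h]
        · exact hf.indicator (measurableSet_lt measurable_const hV)
    _ = ∫⁻ ω, (∫⁻ u in S, f ω * ((if ENNReal.ofReal u < V ω then 1 else 0) * ρ u)) ∂P := by
        refine lintegral_lintegral_swap (Measurable.aemeasurable ?_)
        exact (hf.comp measurable_snd).mul (hite.mul (hρ.comp measurable_fst))
    _ = _ := by
        refine lintegral_congr fun ω => ?_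
        rw [lintegral_const_mul]
        have hmo : Measurable fun u : ℝ => (if ENNReal.ofReal u < V ω then 1 else 0 : ℝ≥0∞) :=
          hite.comp measurable_prodMk_right
        exact hmo.mul hρ

lemma lintegral_tailWeight_le {Ω : Type v} {mΩ : MeasurableSpace Ω} {P : Measure Ω} [SFinite P]
    {V : Ω → ℝ≥0∞} (hV : Measurable V) {p q : ℝ} (hp : 1 ≤ p) (hq : p ≤ q) :
    ∫⁻ ω, tailWeight p q (V ω) ∂P ≤ ENNReal.ofReal (2 ^ q) *
      ∫⁻ u in Set.Ioi (0 : ℝ), P {ω | ENNReal.ofReal u < V ω} *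
        ENNReal.ofReal (min (u ^ (q - 1)) (u ^ (p - 1))) := by
  classical
  have h := setLIntegral_tail_mul_eq (P := P) hV (f := fun _ => 1) measurable_const
    (ρ := fun u => ENNReal.ofReal (min (u ^ (q - 1)) (u ^ (p - 1)))) (by fun_prop) (Set.Ioi 0)
  simp only [setLIntegral_one, one_mul] at h
  rw [h, ← lintegral_const_mul' _ _ ENNReal.ofReal_ne_top]
  refine lintegral_mono fun ω => ?_
  calc tailWeight p q (V ω)
      = ENNReal.ofReal (2 ^ q) * (ENNReal.ofReal (2 ^ (-q)) * tailWeight p q (V ω)) := by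
        rw [← mul_assoc, ← ENNReal.ofReal_mul (by positivity), ← Real.rpow_add (by norm_num)]
        simp
    _ ≤ _ := by
        gcongr
        exact tailWeight_le_lintegral hp hq _

lemma nat_mul_setLIntegral_tail_le {Ω : Type v} {mΩ : MeasurableSpace Ω} {P : Measure Ω}
    [SFinite P] {V : Ω → ℝ≥0∞} (hV : Measurable V) {p q : ℝ} (hp : 1 ≤ p) (hq : p ≤ q) {n : ℕ}
    (hn : 1 ≤ n) :
    (n : ℝ≥0∞) * ∫⁻ u in Set.Ioc (0 : ℝ) 1, P {ω | ENNReal.ofReal u < V ω} *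
        ENNReal.ofReal (u ^ (q - 1))
      ≤ ∫⁻ ω, tailWeight p q ((n : ℝ≥0∞) ^ (1 / p) * V ω) ∂P := by
  classical
  have h := setLIntegral_tail_mul_eq (P := P) hV (f := fun _ => 1) measurable_const
    (ρ := fun u => ENNReal.ofReal (u ^ (q - 1))) (by fun_prop) (Set.Ioc 0 1)
  simp only [setLIntegral_one, one_mul] at h
  rw [h, ← lintegral_const_mul' _ _ (ENNReal.natCast_ne_top n)]
  exact lintegral_mono fun ω => nat_mul_setLIntegral_ite_rpow_le hp hq hn _

/-- An integral of truncated moments of order `p` is bounded by a moment of `tailWeight`. -/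
lemma setLIntegral_truncated_moment_le {Ω : Type v} {mΩ : MeasurableSpace Ω} {P : Measure Ω}
    [SFinite P] {V : Ω → ℝ≥0∞} (hV : Measurable V) {p q : ℝ} (hp : 0 < p) (hq : p < q) :
    ∫⁻ u in Set.Ioc (0 : ℝ) 1, (∫⁻ ω in {ω | ENNReal.ofReal u < V ω}, V ω ^ p ∂P) *
        ENNReal.ofReal (u ^ (q - p - 1))
      ≤ ENNReal.ofReal (1 / (q - p)) * ∫⁻ ω, tailWeight p q (V ω) ∂P := by
  classical
  rw [setLIntegral_tail_mul_eq (P := P) hV (f := fun ω => V ω ^ p) (hV.pow_const p)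
    (ρ := fun u => ENNReal.ofReal (u ^ (q - p - 1))) (by fun_prop) (Set.Ioc 0 1),
    ← lintegral_const_mul' _ _ ENNReal.ofReal_ne_top]
  exact lintegral_mono fun ω => rpow_mul_setLIntegral_ite_rpow_le hp hq _

/-! ### Averages of conditional expectations along a stationary sequence -/

/-- A weak-type bound for averages of conditional expectations: truncate the variables `U j` at the
level `a` and apply Markov's inequality to the rest. -/
lemma measure_lt_sum_condLExp_le {Ω : Type v} {mΩ : MeasurableSpace Ω} {P : Measure Ω}
    [IsProbabilityMeasure P] {F : ℕ → MeasurableSpace Ω} (hF : ∀ j, F j ≤ mΩ)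
    {U : ℕ → Ω → ℝ≥0∞} (hU : ∀ j, Measurable (U j)) {a K : ℝ≥0∞} (ha : a ≠ 0) (ha' : a ≠ ∞)
    (hK : ∀ j, ∫⁻ ω in {ω | a < U j ω}, U j ω ∂P ≤ K) {N n : ℕ} (hN : N ≤ n) (hn : 1 ≤ n) :
    P {ω | n * (2 * a) < ∑ j ∈ Finset.range N, condLExp (F j) P (U j) ω} ≤ K / a := by
  set R : ℕ → Ω → ℝ≥0∞ := fun j => condLExp (F j) P ({ω | a < U j ω}.indicator (U j)) with hR
  have hn0 : (n : ℝ≥0∞) ≠ 0 := by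
    rw [Nat.cast_ne_zero]; omega
  have hbound : ∀ᵐ ω ∂P, ∀ j, condLExp (F j) P (U j) ω ≤ a + R j ω := by
    refine ae_all_iff.2 fun j => ?_
    have h1 : condLExp (F j) P (U j)
        ≤ᵐ[P] condLExp (F j) P ((fun _ => a) + {ω | a < U j ω}.indicator (U j)) := by
      refine condLExp_mono (Filter.Eventually.of_forall fun ω => ?_)
      by_cases h : a < U j ω
      · simp [h]
      · simpa [h] using not_lt.1 h
    have h2 := condLExp_add_left (mΩ := F j) (P := P) (X := fun _ => a)
      ({ω | a < U j ω}.indicator (U j)) aemeasurable_const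
    have h3 := condLExp_const (hF j) P a
    filter_upwards [h1, h2] with ω w1 w2
    rw [w2] at w1
    refine w1.trans ?_
    simp only [Pi.add_apply]
    gcongr
    exact le_of_eq (congrFun h3 ω)
  have hRm : ∀ j, Measurable (R j) := fun j => measurable_condLExp' _ _ _
  have hint : ∫⁻ ω, ∑ j ∈ Finset.range N, R j ω ∂P ≤ n * K := by
    rw [lintegral_finsetSum _ fun j _ => hRm j]
    calc ∑ j ∈ Finset.range N, ∫⁻ ω, R j ω ∂P ≤ ∑ j ∈ Finset.range N, K := by
          refine Finset.sum_le_sum fun j _ => ?_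
          rw [hR, lintegral_condLExp (hF j) P,
            lintegral_indicator (measurableSet_lt measurable_const (hU j))]
          exact hK j
      _ = N * K := by simp
      _ ≤ n * K := by gcongr
  calc P {ω | n * (2 * a) < ∑ j ∈ Finset.range N, condLExp (F j) P (U j) ω}
      ≤ P {ω | n * a ≤ ∑ j ∈ Finset.range N, R j ω} := by
        refine measure_mono_ae ?_
        filter_upwards [hbound] with ω hω (h : n * (2 * a) < _)
        show n * a ≤ ∑ j ∈ Finset.range N, R j ω
        have h1 : ∑ j ∈ Finset.range N, condLExp (F j) P (U j) ω
            ≤ n * a + ∑ j ∈ Finset.range N, R j ω := by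
          calc _ ≤ ∑ j ∈ Finset.range N, (a + R j ω) := Finset.sum_le_sum fun j _ => hω j
            _ = N * a + ∑ j ∈ Finset.range N, R j ω := by
                rw [Finset.sum_add_distrib]; simp
            _ ≤ _ := by gcongr
        have h2 : n * a + n * a ≤ n * a + ∑ j ∈ Finset.range N, R j ω := by
          calc (n : ℝ≥0∞) * a + n * a = n * (2 * a) := by ring
            _ ≤ _ := h.le.trans h1
        exact (ENNReal.add_le_add_iff_left
          (ENNReal.mul_ne_top (ENNReal.natCast_ne_top n) ha')).1 h2
    _ ≤ (∫⁻ ω, ∑ j ∈ Finset.range N, R j ω ∂P) / (n * a) :=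
        meas_ge_le_lintegral_div (Finset.measurable_fun_sum _ fun j _ => hRm j).aemeasurable
          (mul_ne_zero hn0 ha) (ENNReal.mul_ne_top (ENNReal.natCast_ne_top n) ha')
    _ ≤ n * K / (n * a) := by gcongr
    _ = K / a := ENNReal.mul_div_mul_left _ _ hn0 (ENNReal.natCast_ne_top n)

/-- Integrated form of the weak-type bound, for variables `U j` distributed like `W`. -/
lemma setLIntegral_sum_condLExp_tail_le {Ω : Type v} {mΩ : MeasurableSpace Ω} {P : Measure Ω}
    [IsProbabilityMeasure P] {F : ℕ → MeasurableSpace Ω} (hF : ∀ j, F j ≤ mΩ)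
    {U : ℕ → Ω → ℝ≥0∞} (hU : ∀ j, Measurable (U j)) {W : Ω → ℝ≥0∞} (hW : Measurable W)
    (hUW : ∀ j (a : ℝ≥0∞), ∫⁻ ω in {ω | a < U j ω}, U j ω ∂P = ∫⁻ ω in {ω | a < W ω}, W ω ∂P)
    {N n : ℕ} (hN : N ≤ n) (hn : 1 ≤ n) {p q b : ℝ} (hp : 0 < p) (hq : p < q) (hb : 0 < b) :
    ∫⁻ u in Set.Ioc (0 : ℝ) 1,
        P {ω | n * (2 * ENNReal.ofReal (b * u ^ p))
          < ∑ j ∈ Finset.range N, condLExp (F j) P (U j) ω} * ENNReal.ofReal (u ^ (q - 1))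
      ≤ ENNReal.ofReal (1 / (q - p)) *
        ∫⁻ ω, tailWeight p q ((W ω / ENNReal.ofReal b) ^ (1 / p)) ∂P := by
  set β := ENNReal.ofReal b with hβ
  have hβ0 : β ≠ 0 := by simpa [hβ] using hb
  have hβ' : β ≠ ∞ := ENNReal.ofReal_ne_top
  set V : Ω → ℝ≥0∞ := fun ω => (W ω / β) ^ (1 / p) with hV
  have hVm : Measurable V := (hW.div_const β).pow_const _
  have hVp : ∀ ω, W ω = β * V ω ^ p := by
    intro ω
    rw [hV, ← ENNReal.rpow_mul, one_div_mul_cancel hp.ne', ENNReal.rpow_one,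
      ENNReal.mul_div_cancel hβ0 hβ']
  refine le_trans (setLIntegral_mono' measurableSet_Ioc fun u hu => ?_)
    (setLIntegral_truncated_moment_le hVm hp hq)
  have hup : 0 < u ^ p := Real.rpow_pos_of_pos hu.1 p
  set υ := ENNReal.ofReal (u ^ p) with hυ
  have hυ0 : υ ≠ 0 := by simpa [hυ] using hup
  have hυ' : υ ≠ ∞ := ENNReal.ofReal_ne_top
  have ha : ENNReal.ofReal (b * u ^ p) = β * υ := ENNReal.ofReal_mul hb.le
  have hset : {ω | β * υ < W ω} = {ω | ENNReal.ofReal u < V ω} := by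
    ext ω
    simp only [Set.mem_ofPred_eq]
    rw [hVp ω, ENNReal.mul_lt_mul_iff_right hβ0 hβ', hυ, ← ENNReal.ofReal_rpow_of_pos hu.1,
      ENNReal.rpow_lt_rpow_iff hp]
  rw [ha]
  refine (mul_le_mul_left (measure_lt_sum_condLExp_le hF hU (mul_ne_zero hβ0 hυ0)
    (ENNReal.mul_ne_top hβ' hυ') (fun j => (hUW j (β * υ)).le) hN hn) _).trans (le_of_eq ?_)
  rw [hset]
  simp_rw [hVp]
  rw [lintegral_const_mul' _ _ hβ', ENNReal.mul_div_mul_left _ _ hβ0 hβ', div_eq_mul_inv, mul_assoc,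
    hυ, ← ENNReal.ofReal_inv_of_pos hup, ← ENNReal.ofReal_mul (by positivity)]
  congr 2
  rw [← Real.rpow_neg hu.1.le, ← Real.rpow_add hu.1]
  congr 1
  ring

section Stationary

variable {B : Type u} [NormedAddCommGroup B] {Ω : Type v}
  {F₀ mΩ : MeasurableSpace Ω} {P : Measure Ω} {T : Ω ≃ᵐ Ω} {m : Ω → B}

/-- By stationarity, the conditional moments along the orbit of `T` are the translates of a single
one. -/
lemma condMoment_comp_iterate [IsProbabilityMeasure P] (hT : MeasurePreserving T P P) (hF : F₀ ≤ mΩ) (hTF : F₀.map T ≤ F₀)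
    (hF' : ∀ j, F₀.comap T^[j] ≤ mΩ) (hm : StronglyMeasurable m) (p : ℝ) (j : ℕ) :
    (fun ω => condLExp (F₀.map T) P (fun ω' => ‖m ω'‖ₑ ^ p) (T^[j + 1] ω))
      =ᵐ[P] condMoment P (fun i => m ∘ T^[i]) (fun i => F₀.comap T^[i]) p j := by
  set Z := condLExp (F₀.map T) P (fun ω' => ‖m ω'‖ₑ ^ p) with hZ
  have hZm : Measurable[F₀.map T] Z := measurable_condLExp _ _ _
  have hmp : MeasurePreserving T^[j + 1] P P := hT.iterate (j + 1)
  refine ae_eq_condLExp (hF' j) P _ ?_ ?_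
  · intro s hs
    refine ⟨T ⁻¹' (Z ⁻¹' s), hZm hs, ?_⟩
    rw [Function.iterate_succ']
    rfl
  · rintro _ ⟨A, hA, rfl⟩
    have hA' : MeasurableSet[F₀.map T] (T.symm ⁻¹' A) := by
      show MeasurableSet[F₀] (T ⁻¹' (T.symm ⁻¹' A))
      rw [← Set.preimage_comp]
      simpa using hA
    have hpre : T^[j] ⁻¹' A = T^[j + 1] ⁻¹' (T.symm ⁻¹' A) := by
      rw [Function.iterate_succ']
      ext ω
      simp
    have hm0 : MeasurableSet[mΩ] (T.symm ⁻¹' A) := hF _ (hTF _ hA')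
    rw [hpre, hmp.setLIntegral_comp_preimage hm0 (measurable_condLExp' _ _ _),
      setLIntegral_condLExp (hTF.trans hF) P _ hA']
    exact (hmp.setLIntegral_comp_preimage hm0 (hm.enorm.pow_const p)).symm

lemma MeasureTheory.MeasurePreserving.setLIntegral_lt_comp {S : Ω → Ω}
    (hS : MeasurePreserving S P P) {W : Ω → ℝ≥0∞} (hW : Measurable W) (a : ℝ≥0∞) :
    ∫⁻ ω in {ω | a < W (S ω)}, W (S ω) ∂P = ∫⁻ ω in {ω | a < W ω}, W ω ∂P :=
  hS.setLIntegral_comp_preimage (measurableSet_lt measurable_const hW) hW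

end Stationary

/-! ### The stationary maximal inequality -/

lemma setOf_mul_lt_norm_eq {B : Type u} [NormedAddCommGroup B] {Ω : Type v} (m : Ω → B) {y u : ℝ}
    (hy : 0 < y) (hu : 0 ≤ u) :
    {ω | y * u < ‖m ω‖} = {ω | ENNReal.ofReal u < ‖m ω‖ₑ / ENNReal.ofReal y} := by
  ext ω
  simp only [Set.mem_ofPred_eq]
  rw [ENNReal.lt_div_iff_mul_lt (Or.inl (by simpa using hy)) (Or.inl ENNReal.ofReal_ne_top),
    ← ENNReal.ofReal_mul hu, ← ofReal_norm, mul_comm y u]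
  exact (ENNReal.ofReal_lt_ofReal_iff_of_nonneg (by positivity)).symm

lemma exists_lt_norm_of_lt_maxNormPartialSum {B : Type u} [NormedAddCommGroup B] {Ω : Type v}
    {T : Ω → Ω} {m : Ω → B} {n : ℕ} {ω : Ω} {y : ℝ} (hy : 0 ≤ y)
    (h : y < (maxNormPartialSum T m n ω : ℝ)) :
    ∃ k ≤ n, y < ‖∑ i ∈ Finset.range k, (m ∘ T^[i]) ω‖ := by
  lift y to ℝ≥0 using hy
  rw [NNReal.coe_lt_coe, maxNormPartialSum, Finset.lt_sup_iff] at h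
  obtain ⟨k, hk, hk'⟩ := h
  refine ⟨k, (Finset.mem_Icc.1 hk).2, ?_⟩
  have h2 : (y : ℝ) < ‖birkhoffSum T m k ω‖ := by exact_mod_cast hk'
  simpa [birkhoffSum] using h2

section Core

variable {B : Type u} [NormedAddCommGroup B] [NormedSpace ℝ B] [CompleteSpace B] {Ω : Type v}
  {F₀ mΩ : MeasurableSpace Ω} {P : Measure Ω} [IsProbabilityMeasure P] {T : Ω ≃ᵐ Ω} {m : Ω → B}

/-- The tail of the maximal partial sum of a stationary martingale, in terms of the tails of the
increment and of the sum of the conditional moments. -/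
lemma measure_lt_maxNormPartialSum_le {r p q δ x : ℝ} {D : ℝ≥0∞} (hp : 1 ≤ p) (hr : p ≤ r)
    (hq : 1 ≤ q) (hT : MeasurePreserving T P P)
    (hX : IsMartingaleDifference P (fun i => m ∘ T^[i]) (fun i => F₀.comap T^[i]))
    (hsmooth : ∀ (Y : ℕ → Ω → B) (F : ℕ → MeasurableSpace Ω), IsMartingaleDifference P Y F →
      ∀ n : ℕ, ∫⁻ ω, ‖∑ i ∈ Finset.range n, Y i ω‖ₑ ^ r ∂P
        ≤ D * ∑ i ∈ Finset.range n, ∫⁻ ω, ‖Y i ω‖ₑ ^ r ∂P)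
    (hδ : 0 < δ) (hδ' : 2 * δ ≤ 1)
    (hδD : D * 2 ^ r * ENNReal.ofReal δ ^ r ≤ ENNReal.ofReal (3 ^ (-q)))
    (hx : 0 < x) (N : ℕ) :
    P {ω | x * ((N + 1 : ℕ) : ℝ) ^ (1 / p) < (maxNormPartialSum T m (N + 1) ω : ℝ)}
      ≤ ENNReal.ofReal (3 ^ q) *
        (((N + 1 : ℕ) : ℝ≥0∞) * (∫⁻ u in Set.Ioc (0 : ℝ) 1,
            P {ω | δ / 3 * x * ((N + 1 : ℕ) : ℝ) ^ (1 / p) * u < ‖m ω‖} *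
              ENNReal.ofReal (u ^ (q - 1)))
          + ∫⁻ u in Set.Ioc (0 : ℝ) 1,
            P {ω | ((N + 1 : ℕ) : ℝ≥0∞) * (2 * ENNReal.ofReal ((δ / 3) ^ p / 2 * x ^ p * u ^ p))
              < ∑ j ∈ Finset.range N,
                condMoment P (fun i => m ∘ T^[i]) (fun i => F₀.comap T^[i]) p j ω} *
              ENNReal.ofReal (u ^ (q - 1))) := by
  set n : ℕ := N + 1 with hn
  have hp0 : 0 < p := by linarith
  have hn0 : (0 : ℝ) < n := by positivity
  set Z := condMoment P (fun i => m ∘ T^[i]) (fun i => F₀.comap T^[i]) p with hZ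
  set g : ℝ → ℝ≥0∞ := fun l => P {ω | ∃ k ≤ n, l < ‖∑ i ∈ Finset.range k, (m ∘ T^[i]) ω‖}
  set h : ℝ → ℝ≥0∞ := fun l => P {ω | ∃ i < n, δ * l < ‖(m ∘ T^[i]) ω‖}
    + P {ω | ENNReal.ofReal (δ * l) ^ p < ∑ j ∈ Finset.range N, Z j ω} with hh
  have hanti : AntitoneOn h (Set.Ioi 0) := by
    intro l _ l' _ hll
    have hmul : δ * l ≤ δ * l' := by gcongr
    refine add_le_add (measure_mono ?_) (measure_mono ?_)
    · rintro ω ⟨i, hi, hi'⟩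
      exact ⟨i, hi, hmul.trans_lt hi'⟩
    · intro ω (hω : ENNReal.ofReal (δ * l') ^ p < _)
      exact (ENNReal.rpow_le_rpow (ENNReal.ofReal_le_ofReal hmul) hp0.le).trans_lt hω
  have H : ∀ l, 0 < l → g (3 * l) ≤ ENNReal.ofReal (3 ^ (-q)) * g l + h l := by
    intro l hl
    have := hX.good_lambda (r := r) (D := D) (l := l) (a := δ * l) hp hr
      (fun Y hY => hsmooth Y _ hY) (by positivity) (by nlinarith) N
    rw [mul_div_cancel_right₀ _ hl.ne'] at this
    refine this.trans ?_
    gcongr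
  have hy : 0 < x * (n : ℝ) ^ (1 / p) / 3 := by positivity
  have key := le_lintegral_of_three_mul_le hq (g := g) (h := h) (fun _ => prob_le_one) hanti H hy
  have e3 : 3 * (x * (n : ℝ) ^ (1 / p) / 3) = x * (n : ℝ) ^ (1 / p) := by ring
  rw [e3] at key
  refine (measure_mono fun ω hω => ?_).trans (key.trans ?_)
  · exact exists_lt_norm_of_lt_maxNormPartialSum (by positivity) hω
  have hmm : StronglyMeasurable m := by
    simpa using (hX.measurable 0).mono (hX.le 0)
  gcongr
  rw [← lintegral_const_mul' _ _ (ENNReal.natCast_ne_top n), ← lintegral_add_left]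
  swap
  · refine Measurable.const_mul (Measurable.mul ?_ (by fun_prop)) _
    refine Antitone.measurable fun u u' huu => measure_mono fun ω
      (hω : δ / 3 * x * (n : ℝ) ^ (1 / p) * u' < _) => lt_of_le_of_lt ?_ hω
    gcongr
  refine setLIntegral_mono' measurableSet_Ioc fun u hu => ?_
  have hu0 : 0 < u := hu.1
  rw [← mul_assoc, ← add_mul]
  gcongr ?_ * _
  refine add_le_add ?_ (le_of_eq ?_)
  · have hsub : {ω | ∃ i < n, δ * (x * (n : ℝ) ^ (1 / p) / 3 * u) < ‖(m ∘ T^[i]) ω‖}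
        ⊆ ⋃ i ∈ Finset.range n,
          T^[i] ⁻¹' {ω | δ / 3 * x * (n : ℝ) ^ (1 / p) * u < ‖m ω‖} := by
      rintro ω ⟨i, hi, hi'⟩
      simp only [Set.mem_iUnion, Finset.mem_range]
      refine ⟨i, hi, ?_⟩
      refine lt_of_eq_of_lt ?_ hi'
      ring
    refine (measure_mono hsub).trans ((measure_biUnion_finset_le _ _).trans (le_of_eq ?_))
    have hme : ∀ i, P (T^[i] ⁻¹' {ω | δ / 3 * x * (n : ℝ) ^ (1 / p) * u < ‖m ω‖})
        = P {ω | δ / 3 * x * (n : ℝ) ^ (1 / p) * u < ‖m ω‖} := fun i =>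
      (hT.iterate i).measure_preimage
        (measurableSet_lt measurable_const hmm.norm.measurable).nullMeasurableSet
    simp_rw [hme]
    simp
  · congr 1
    ext ω
    simp only [Set.mem_ofPred_eq]
    rw [ENNReal.ofReal_rpow_of_pos (by positivity), ← ENNReal.ofReal_natCast (n := n),
      ← ENNReal.ofReal_ofNat, ← ENNReal.ofReal_mul (by norm_num),
      ← ENNReal.ofReal_mul (by positivity)]
    have e : (δ * (x * (n : ℝ) ^ (1 / p) / 3 * u)) ^ p
        = n * (2 * ((δ / 3) ^ p / 2 * x ^ p * u ^ p)) := by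
      have e1 : δ * (x * (n : ℝ) ^ (1 / p) / 3 * u) = δ / 3 * x * u * (n : ℝ) ^ (1 / p) := by ring
      rw [e1, Real.mul_rpow (by positivity) (by positivity), ← Real.rpow_mul hn0.le,
        one_div_mul_cancel hp0.ne', Real.rpow_one, Real.mul_rpow (by positivity) hu0.le,
        Real.mul_rpow (by positivity) hx.le]
      ring
    rw [e]

/-- The contribution of the conditional moments, expressed through the conditional moment of a single
increment. -/
lemma setLIntegral_sum_condMoment_tail_le_condLExp {p q b : ℝ} (hp : 0 < p) (hq : p < q) (hb : 0 < b)
    (hT : MeasurePreserving T P P) (hF : F₀ ≤ mΩ) (hTF : F₀.map T ≤ F₀)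
    (hX : IsMartingaleDifference P (fun i => m ∘ T^[i]) (fun i => F₀.comap T^[i])) (N : ℕ) :
    ∫⁻ u in Set.Ioc (0 : ℝ) 1,
        P {ω | ((N + 1 : ℕ) : ℝ≥0∞) * (2 * ENNReal.ofReal (b * u ^ p))
          < ∑ j ∈ Finset.range N,
            condMoment P (fun i => m ∘ T^[i]) (fun i => F₀.comap T^[i]) p j ω} *
          ENNReal.ofReal (u ^ (q - 1))
      ≤ ENNReal.ofReal (1 / (q - p)) * ∫⁻ ω, tailWeight p q
        ((condLExp (F₀.map T) P (fun ω' => ‖m ω'‖ₑ ^ p) ω / ENNReal.ofReal b) ^ (1 / p)) ∂P := by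
  have hmm : StronglyMeasurable m := by
    simpa using (hX.measurable 0).mono (hX.le 0)
  set Z := condLExp (F₀.map T) P (fun ω' => ‖m ω'‖ₑ ^ p) with hZ
  have hZm : Measurable Z := measurable_condLExp' _ _ _
  have hZ' : Measurable[F₀.map T] Z := measurable_condLExp _ _ _
  -- The translates of `Z` are their own conditional expectations, so the truncation may be applied to
  -- them instead of to the `p`-th powers of the increments.
  set U : ℕ → Ω → ℝ≥0∞ := fun j ω => Z (T^[j + 1] ω) with hU
  have hUF : ∀ j, Measurable[F₀.comap T^[j]] (U j) := by
    intro j s hs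
    refine ⟨T ⁻¹' (Z ⁻¹' s), hZ' hs, ?_⟩
    ext ω
    simp [hU, Function.iterate_succ_apply']
  have hUe : ∀ᵐ ω ∂P, ∀ j, condMoment P (fun i => m ∘ T^[i]) (fun i => F₀.comap T^[i]) p j ω
      = condLExp (F₀.comap T^[j]) P (U j) ω := by
    refine ae_all_iff.2 fun j => ?_
    rw [condLExp_eq_self (hX.le j) P (hUF j)]
    exact (condMoment_comp_iterate hT hF hTF hX.le hmm p j).symm
  refine le_trans (le_of_eq (lintegral_congr fun u => ?_))
    (setLIntegral_sum_condLExp_tail_le (N := N) (n := N + 1) hX.le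
      (fun j => (hUF j).mono (hX.le j) le_rfl) hZm
      (fun j a => (hT.iterate (j + 1)).setLIntegral_lt_comp hZm a) (Nat.le_succ N)
      (Nat.le_add_left 1 N) hp hq hb)
  congr 1
  refine measure_congr ?_
  filter_upwards [hUe] with ω hω
  refine propext ?_
  show _ < _ ↔ _ < _
  simp only [hω]

/-- The contribution of the conditional moments, expressed through the increment itself. -/
lemma setLIntegral_sum_condMoment_tail_le_norm {p q b : ℝ} (hp : 0 < p) (hq : p < q) (hb : 0 < b)
    (hT : MeasurePreserving T P P)
    (hX : IsMartingaleDifference P (fun i => m ∘ T^[i]) (fun i => F₀.comap T^[i])) (N : ℕ) :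
    ∫⁻ u in Set.Ioc (0 : ℝ) 1,
        P {ω | ((N + 1 : ℕ) : ℝ≥0∞) * (2 * ENNReal.ofReal (b * u ^ p))
          < ∑ j ∈ Finset.range N,
            condMoment P (fun i => m ∘ T^[i]) (fun i => F₀.comap T^[i]) p j ω} *
          ENNReal.ofReal (u ^ (q - 1))
      ≤ ENNReal.ofReal (1 / (q - p)) * ∫⁻ ω, tailWeight p q
        ((‖m ω‖ₑ ^ p / ENNReal.ofReal b) ^ (1 / p)) ∂P := by
  have hmm : StronglyMeasurable m := by
    simpa using (hX.measurable 0).mono (hX.le 0)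
  have hW : Measurable fun ω => ‖m ω‖ₑ ^ p := hmm.enorm.pow_const p
  exact setLIntegral_sum_condLExp_tail_le (N := N) (n := N + 1)
    (U := fun j ω => ‖m (T^[j + 1] ω)‖ₑ ^ p) hX.le
    (fun j => hW.comp (hT.iterate (j + 1)).measurable) hW
    (fun j a => (hT.iterate (j + 1)).setLIntegral_lt_comp hW a) (Nat.le_succ N)
    (Nat.le_add_left 1 N) hp hq hb

end Core

/-! ### The two bounds with uniform constants -/

/-- A change of scale in the integrated tail of `‖m‖`: the moment of `tailWeight` of a multiple of
`‖m‖` is bounded by the integrated tail of `‖m‖ / x`. -/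
lemma lintegral_tailWeight_mul_norm_le {B : Type u} [NormedAddCommGroup B] {Ω : Type v}
    {mΩ : MeasurableSpace Ω} {P : Measure Ω} [SFinite P] {m : Ω → B} (hm : StronglyMeasurable m)
    {p q x : ℝ} (hp : 1 ≤ p) (hq : p ≤ q) (hx : 0 < x) {k : ℝ} (hk : 1 ≤ k) :
    ∫⁻ ω, tailWeight p q (ENNReal.ofReal k * (‖m ω‖ₑ / ENNReal.ofReal x)) ∂P
      ≤ ENNReal.ofReal (k ^ q * 2 ^ q) * ∫⁻ u in Set.Ioi (0 : ℝ), P {ω | x * u < ‖m ω‖} *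
          ENNReal.ofReal (min (u ^ (q - 1)) (u ^ (p - 1))) := by
  have hV : Measurable fun ω => ‖m ω‖ₑ / ENNReal.ofReal x := hm.enorm.div_const _
  have hk' : (1 : ℝ≥0∞) ≤ ENNReal.ofReal k := ENNReal.one_le_ofReal.2 hk
  calc _ ≤ ∫⁻ ω, ENNReal.ofReal k ^ q * tailWeight p q (‖m ω‖ₑ / ENNReal.ofReal x) ∂P :=
        lintegral_mono fun ω => tailWeight_mul_le (by linarith) hq hk' _
    _ = ENNReal.ofReal (k ^ q) * ∫⁻ ω, tailWeight p q (‖m ω‖ₑ / ENNReal.ofReal x) ∂P := by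
        rw [ENNReal.ofReal_rpow_of_pos (by linarith), lintegral_const_mul' _ _ ENNReal.ofReal_ne_top]
    _ ≤ ENNReal.ofReal (k ^ q) * (ENNReal.ofReal (2 ^ q) * _) := by
        gcongr
        exact lintegral_tailWeight_le hV hp hq
    _ = _ := by
        rw [← mul_assoc, ← ENNReal.ofReal_mul (by positivity)]
        congr 1
        refine setLIntegral_congr_fun measurableSet_Ioi fun u hu => ?_
        rw [setOf_mul_lt_norm_eq m hx (le_of_lt hu)]

theorem theorem2 (p q D : ℝ) (hp : 1 < p) (hq : p < q) :
    ∃ C c : ℝ, 0 < C ∧ 0 < c ∧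
      ∀ (r : ℝ), p ≤ r →
      ∀ (B : Type u) [NormedAddCommGroup B] [NormedSpace ℝ B] [CompleteSpace B]
        [TopologicalSpace.SeparableSpace B], IsSmoothSpaceWith.{u, v} B r D →
      ∀ (Ω : Type v) (mΩ : MeasurableSpace Ω) (P : Measure Ω) [IsProbabilityMeasure P]
        (T : Ω ≃ᵐ Ω), MeasurePreserving T P P →
      ∀ (F₀ : MeasurableSpace Ω), F₀ ≤ mΩ → F₀.map T ≤ F₀ →
      ∀ (m : Ω → B),
        IsMartingaleDifference P (fun i => m ∘ T^[i]) (fun i => F₀.comap T^[i]) →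
      ∀ (n : ℕ) (x : ℝ), 1 ≤ n → 0 < x →
        (P {ω | x * (n : ℝ) ^ (1 / p) < (maxNormPartialSum T m n ω : ℝ)}
            ≤ ENNReal.ofReal C * (n : ℝ≥0∞) *
                (∫⁻ u in Set.Ioc (0 : ℝ) 1,
                  P {ω | c * x * u * (n : ℝ) ^ (1 / p) < ‖m ω‖} * ENNReal.ofReal (u ^ (q - 1)))
              + ENNReal.ofReal C *
                (∫⁻ u in Set.Ioi (0 : ℝ),
                  P {ω | ENNReal.ofReal (c * x ^ p * u ^ p)
                      < condLExp (F₀.map T) P (fun ω' => ‖m ω'‖ₑ ^ p) ω}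
                    * ENNReal.ofReal (min (u ^ (q - 1)) (u ^ (p - 1))))) ∧
        (P {ω | x * (n : ℝ) ^ (1 / p) < (maxNormPartialSum T m n ω : ℝ)}
            ≤ ENNReal.ofReal C *
                ∫⁻ u in Set.Ioi (0 : ℝ),
                  P {ω | x * u < ‖m ω‖} * ENNReal.ofReal (min (u ^ (q - 1)) (u ^ (p - 1)))) := by
  have hp0 : 0 < p := by linarith
  have hqp : 0 < q - p := by linarith
  -- `δ` makes the contraction factor of the good-λ inequality at most `3 ^ (-q)`, for all `r ≤ 2`.
  set δ : ℝ := min (1 / 2) (3 ^ (-q) / (4 * (|D| + 1))) with hδdef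
  have hδ : 0 < δ := lt_min (by norm_num) (by positivity)
  have hδ2 : 2 * δ ≤ 1 := by
    have : δ ≤ 1 / 2 := min_le_left _ _
    linarith
  set c₁ : ℝ := δ / 3 with hc₁
  set c₂ : ℝ := (δ / 3) ^ p / 2 with hc₂
  have hc₁0 : 0 < c₁ := by positivity
  have hc₂0 : 0 < c₂ := by positivity
  have hc₁1 : c₁ ≤ 1 := by linarith
  have hc₂1 : c₂ ≤ 1 := by
    have : (δ / 3) ^ p ≤ 1 := Real.rpow_le_one hc₁0.le hc₁1 hp0.le
    linarith
  set k₁ : ℝ := c₁⁻¹ with hk₁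
  set k₂ : ℝ := (c₂⁻¹) ^ (1 / p) with hk₂
  have hk₁1 : 1 ≤ k₁ := (one_le_inv₀ hc₁0).2 hc₁1
  have hk₂1 : 1 ≤ k₂ := Real.one_le_rpow ((one_le_inv₀ hc₂0).2 hc₂1) (by positivity)
  set A₁ : ℝ := 3 ^ q with hA₁
  set A₂ : ℝ := 3 ^ q * (1 / (q - p) * 2 ^ q) with hA₂
  set A₃ : ℝ := 3 ^ q * (k₁ ^ q * 2 ^ q + 1 / (q - p) * (k₂ ^ q * 2 ^ q)) with hA₃
  have hA₁0 : 0 < A₁ := by positivity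
  have hA₂0 : 0 < A₂ := by positivity
  have hA₃0 : 0 < A₃ := by positivity
  refine ⟨A₁ + A₂ + A₃, min c₁ c₂, by positivity, lt_min hc₁0 hc₂0, ?_⟩
  intro r hpr B _ _ _ _ hB Ω mΩ P _ T hT F₀ hF hTF m hX n x hn hx
  obtain ⟨⟨-, hr2, -⟩, hsm⟩ := hB
  obtain ⟨N, rfl⟩ : ∃ N, n = N + 1 := ⟨n - 1, by omega⟩
  have hmm : StronglyMeasurable[mΩ] m := by
    simpa using (hX.measurable 0).mono (hX.le 0)
  have hr1 : 1 ≤ r := by linarith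
  have hδD : ENNReal.ofReal D * 2 ^ r * ENNReal.ofReal δ ^ r ≤ ENNReal.ofReal (3 ^ (-q)) := by
    have h2 : (2 : ℝ≥0∞) = ENNReal.ofReal 2 := by simp
    calc ENNReal.ofReal D * 2 ^ r * ENNReal.ofReal δ ^ r
        ≤ ENNReal.ofReal (|D| + 1) * ENNReal.ofReal (2 ^ r) * ENNReal.ofReal (δ ^ r) := by
          rw [h2, ENNReal.ofReal_rpow_of_pos (by norm_num), ENNReal.ofReal_rpow_of_pos hδ]
          gcongr
          linarith [le_abs_self D]
      _ = ENNReal.ofReal ((|D| + 1) * 2 ^ r * δ ^ r) := by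
          rw [← ENNReal.ofReal_mul (by positivity), ← ENNReal.ofReal_mul (by positivity)]
      _ ≤ _ := by
          apply ENNReal.ofReal_le_ofReal
          have e2 : (2 : ℝ) ^ r ≤ 4 := by
            calc (2 : ℝ) ^ r ≤ 2 ^ (2 : ℝ) := Real.rpow_le_rpow_of_exponent_le (by norm_num) hr2
              _ = 4 := by norm_num
          have eδ : δ ^ r ≤ δ := by
            calc δ ^ r ≤ δ ^ (1 : ℝ) := Real.rpow_le_rpow_of_exponent_ge hδ (by linarith) hr1
              _ = δ := Real.rpow_one δ
          calc (|D| + 1) * 2 ^ r * δ ^ r ≤ (|D| + 1) * 4 * (3 ^ (-q) / (4 * (|D| + 1))) := by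
                gcongr
                exact eδ.trans (min_le_right _ _)
            _ = 3 ^ (-q) := by
                have : (|D| + 1) ≠ 0 := by positivity
                field_simp
  have hmain := measure_lt_maxNormPartialSum_le (q := q) hp.le hpr (by linarith) hT hX
    (fun Y F hY => hsm Ω mΩ P inferInstance Y F hY) hδ hδ2 hδD hx N
  have hb : 0 < (δ / 3) ^ p / 2 * x ^ p := by positivity
  have hnp : (0 : ℝ) < ((N + 1 : ℕ) : ℝ) ^ (1 / p) := by positivity
  constructor
  · refine hmain.trans ?_
    rw [mul_add, mul_assoc (ENNReal.ofReal (A₁ + A₂ + A₃))]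
    refine add_le_add ?_ ?_
    · gcongr ?_ * (_ * ?_)
      · exact ENNReal.ofReal_le_ofReal (by linarith)
      · refine setLIntegral_mono' measurableSet_Ioc fun u hu => ?_
        gcongr ?_ * _
        refine measure_mono fun ω (hω : δ / 3 * x * _ * u < _) => lt_of_le_of_lt ?_ hω
        calc min c₁ c₂ * x * u * ((N + 1 : ℕ) : ℝ) ^ (1 / p)
            ≤ c₁ * x * u * ((N + 1 : ℕ) : ℝ) ^ (1 / p) := by
              have := hu.1.le
              gcongr
              exact min_le_left _ _
          _ = _ := by ring
    · set Z := condLExp (F₀.map T) P (fun ω' => ‖m ω'‖ₑ ^ p) with hZ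
      have hZm : Measurable[mΩ] Z := measurable_condLExp' _ _ _
      set β := ENNReal.ofReal ((δ / 3) ^ p / 2 * x ^ p) with hβ
      have hβ0 : β ≠ 0 := by simpa [hβ] using hb
      have hβ' : β ≠ ∞ := ENNReal.ofReal_ne_top
      have hVm : Measurable[mΩ] fun ω => (Z ω / β) ^ (1 / p) := (hZm.div_const β).pow_const _
      calc _ ≤ ENNReal.ofReal A₁ * (ENNReal.ofReal (1 / (q - p)) * (ENNReal.ofReal (2 ^ q) *
            ∫⁻ u in Set.Ioi (0 : ℝ), P {ω | ENNReal.ofReal u < (Z ω / β) ^ (1 / p)} *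
              ENNReal.ofReal (min (u ^ (q - 1)) (u ^ (p - 1))))) := by
            gcongr
            refine (setLIntegral_sum_condMoment_tail_le_condLExp hp0 hq hb hT hF hTF hX N).trans ?_
            gcongr
            exact lintegral_tailWeight_le hVm hp.le hq.le
        _ = ENNReal.ofReal A₂ *
            ∫⁻ u in Set.Ioi (0 : ℝ), P {ω | ENNReal.ofReal u < (Z ω / β) ^ (1 / p)} *
              ENNReal.ofReal (min (u ^ (q - 1)) (u ^ (p - 1))) := by
            rw [hA₂, ENNReal.ofReal_mul (by positivity), ENNReal.ofReal_mul (by positivity)]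
            ring
        _ ≤ _ := by
            gcongr ?_ * ?_
            · exact ENNReal.ofReal_le_ofReal (by linarith)
            · refine setLIntegral_mono' measurableSet_Ioi fun u hu => ?_
              have hu0 : 0 < u := hu
              gcongr ?_ * _
              refine measure_mono fun ω (hω : ENNReal.ofReal u < (Z ω / β) ^ (1 / p)) => ?_
              show ENNReal.ofReal (min c₁ c₂ * x ^ p * u ^ p) < Z ω
              have h1 : ENNReal.ofReal (u ^ p) < Z ω / β := by
                have := ENNReal.rpow_lt_rpow hω hp0
                rwa [← ENNReal.rpow_mul, one_div_mul_cancel hp0.ne', ENNReal.rpow_one,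
                  ENNReal.ofReal_rpow_of_pos hu0] at this
              rw [ENNReal.lt_div_iff_mul_lt (Or.inl hβ0) (Or.inl hβ'), hβ,
                ← ENNReal.ofReal_mul (by positivity)] at h1
              refine lt_of_le_of_lt (ENNReal.ofReal_le_ofReal ?_) h1
              calc min c₁ c₂ * x ^ p * u ^ p ≤ c₂ * x ^ p * u ^ p := by
                    gcongr
                    exact min_le_right _ _
                _ = _ := by ring
  · refine hmain.trans ?_
    set J := ∫⁻ u in Set.Ioi (0 : ℝ),
      P {ω | x * u < ‖m ω‖} * ENNReal.ofReal (min (u ^ (q - 1)) (u ^ (p - 1))) with hJ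
    have hfirst : (((N + 1 : ℕ) : ℝ≥0∞) * (∫⁻ u in Set.Ioc (0 : ℝ) 1,
            P {ω | δ / 3 * x * ((N + 1 : ℕ) : ℝ) ^ (1 / p) * u < ‖m ω‖} *
              ENNReal.ofReal (u ^ (q - 1)))) ≤ ENNReal.ofReal (k₁ ^ q * 2 ^ q) * J := by
      have hy : 0 < δ / 3 * x * ((N + 1 : ℕ) : ℝ) ^ (1 / p) := by positivity
      have hVm : Measurable[mΩ] fun ω =>
          ‖m ω‖ₑ / ENNReal.ofReal (δ / 3 * x * ((N + 1 : ℕ) : ℝ) ^ (1 / p)) :=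
        hmm.enorm.div_const _
      have hcongr : ∫⁻ u in Set.Ioc (0 : ℝ) 1,
            P {ω | δ / 3 * x * ((N + 1 : ℕ) : ℝ) ^ (1 / p) * u < ‖m ω‖} *
              ENNReal.ofReal (u ^ (q - 1)) = ∫⁻ u in Set.Ioc (0 : ℝ) 1,
            P {ω | ENNReal.ofReal u <
              ‖m ω‖ₑ / ENNReal.ofReal (δ / 3 * x * ((N + 1 : ℕ) : ℝ) ^ (1 / p))} *
              ENNReal.ofReal (u ^ (q - 1)) := by
        refine setLIntegral_congr_fun measurableSet_Ioc fun u hu => ?_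
        rw [setOf_mul_lt_norm_eq m hy hu.1.le]
      rw [hcongr]
      refine (nat_mul_setLIntegral_tail_le hVm hp.le hq.le hn).trans (le_trans (le_of_eq ?_)
        (lintegral_tailWeight_mul_norm_le hmm hp.le hq.le hx hk₁1))
      refine lintegral_congr fun ω => ?_
      congr 1
      have hn' : (((N + 1 : ℕ) : ℝ≥0∞)) ^ (1 / p)
          = ENNReal.ofReal (((N + 1 : ℕ) : ℝ) ^ (1 / p)) := by
        rw [← ENNReal.ofReal_rpow_of_pos (by positivity), ENNReal.ofReal_natCast]
      rw [hn', ← hc₁, ENNReal.ofReal_mul (by positivity), ENNReal.ofReal_mul (by positivity), hk₁,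
        ENNReal.ofReal_inv_of_pos hc₁0]
      set ν := ENNReal.ofReal (((N + 1 : ℕ) : ℝ) ^ (1 / p)) with hν
      have hν0 : ν ≠ 0 := by simpa only [hν, ne_eq, ENNReal.ofReal_eq_zero, not_le] using hnp
      have hν' : ν ≠ ∞ := ENNReal.ofReal_ne_top
      rw [mul_comm _ ν, ← mul_div_assoc, ENNReal.mul_div_mul_left _ _ hν0 hν', div_eq_mul_inv,
        ENNReal.mul_inv (Or.inr ENNReal.ofReal_ne_top) (Or.inl ENNReal.ofReal_ne_top),
        div_eq_mul_inv ‖m ω‖ₑ]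
      ring
    have hsecond := setLIntegral_sum_condMoment_tail_le_norm (F₀ := F₀) hp0 hq hb hT hX N
    have hscale : ∫⁻ ω, tailWeight p q
        ((‖m ω‖ₑ ^ p / ENNReal.ofReal ((δ / 3) ^ p / 2 * x ^ p)) ^ (1 / p)) ∂P
        ≤ ENNReal.ofReal (k₂ ^ q * 2 ^ q) * J := by
      refine le_trans (le_of_eq (lintegral_congr fun ω => ?_))
        (lintegral_tailWeight_mul_norm_le hmm hp.le hq.le hx hk₂1)
      congr 1
      rw [hk₂, ← ENNReal.ofReal_rpow_of_pos (inv_pos.2 hc₂0), ENNReal.ofReal_inv_of_pos hc₂0,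
        ENNReal.ofReal_mul hc₂0.le, ← ENNReal.ofReal_rpow_of_pos hx, div_eq_mul_inv,
        ENNReal.mul_inv (Or.inr (by simp [hp0.le])) (Or.inl ENNReal.ofReal_ne_top),
        ← ENNReal.inv_rpow, mul_left_comm, ← ENNReal.mul_rpow_of_nonneg _ _ hp0.le,
        ENNReal.mul_rpow_of_nonneg _ _ (by positivity), ← ENNReal.rpow_mul,
        mul_one_div_cancel hp0.ne', ENNReal.rpow_one,
        div_eq_mul_inv ‖m ω‖ₑ]
    calc _ ≤ ENNReal.ofReal A₁ * (ENNReal.ofReal (k₁ ^ q * 2 ^ q) * J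
          + ENNReal.ofReal (1 / (q - p)) * (ENNReal.ofReal (k₂ ^ q * 2 ^ q) * J)) := by
          gcongr
          refine hsecond.trans ?_
          gcongr
      _ = ENNReal.ofReal A₃ * J := by
          rw [hA₃, ENNReal.ofReal_mul (p := 3 ^ q) (by positivity), ENNReal.ofReal_add
            (by positivity) (by positivity), ENNReal.ofReal_mul (p := 1 / (q - p)) (by positivity)]
          ring
      _ ≤ _ := by
          gcongr
          linarith
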